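/- **Setting.** Consider an access point (AP) with $N$ antennas and $K$ users, block length $T>0$, harvesting efficiency $0<\zeta\le 1$, bandwidth $B>0$, noise power $\sigma^2>0$, and energy consumption $\alpha>0$ of the AP per offloaded bit. User $i$ has $R_i>0$ input bits, needs $C_i>0$ CPU cycles per bit, and has capacitance coefficient $\kappa_i>0$, circuit power $p_{c,i}>0$, maximum CPU frequency $f_i^{\max}$, downlink channel $\boldsymbol h_i\in\mathbb C^N$ with $\boldsymbol H_i=\boldsymbol h_i\boldsymbol h_i^H$, and uplink channel $\boldsymbol g_i\in\mathbb C^N\setminus\{0\}$ with $\tilde g_i=\|\boldsymbol g_i\|^2$. Put $\beta(x)=\sigma^2(2^{x/B}-1)$, with $t\,\beta(\ell/t)=0$ if $t=0$. For real $x\ge 0$ let $\sum_{n=1}^{x}a_n=\sum_{n=1}^{\lfloor x\rfloor}a_n+(x-\lfloor x\rfloor)a_{\lfloor x\rfloor+1}$ (a last, incomplete CPU cycle counts by its fraction). **Problem (P1).** Minimize $T\,\mathrm{tr}(\boldsymbol Q)+\sum_{i=1}^K\alpha\ell_i$ over $\boldsymbol Q\succeq 0$, $\boldsymbol t$, $\boldsymbol\ell$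 and $\{f_{i,n}\}$ subject to, for all $i$, $$\sum_{n=1}^{C_i(R_i-\ell_i)}\frac1{f_{i,n}}\le T,\qquad \sum_{n=1}^{C_i(R_i-\ell_i)}\kappa_if_{i,n}^2+\frac{t_i}{\tilde g_i}\beta\Big(\frac{\ell_i}{t_i}\Big)+p_{c,i}t_i-T\zeta\,\mathrm{tr}(\boldsymbol Q\boldsymbol H_i)\le 0,$$ $$\sum_{j=1}^K t_j\le T,\qquad t_i\ge0,\qquad 0\le\ell_i\le R_i,\qquad \ell_i=0\ \text{if}\ t_i=0,$$ and $0<f_{i,n}\le f_i^{\max}$ for every (complete or incomplete) cycle $n$ in use. **Dual problem.** With all frequencies of user $i$ set to $C_i(R_i-\ell_i)/T$, and with multipliers $\lambda_i\ge 0$ for the energy constraints and $\mu\ge 0$ for $\sum_i t_i\le T$, the partial Lagrangian is $$\mathcal L=T\,\mathrm{tr}\big(\boldsymbol F(\boldsymbol\lambda)\boldsymbol Q\big)-\mu T+\sum_{i=1}^K\Big(\alpha\ell_i+\frac{\lambda_i\kappa_iC_i^3(R_i-\ell_i)^3}{T^2}+\frac{\lambda_it_i}{\tilde g_i}\beta\Big(\frac{\ell_i}{t_i}\Big)+\lambda_ip_{c,i}t_i+\mu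 t_i\Big),\qquad \boldsymbol F(\boldsymbol\lambda)=\boldsymbol I-\sum_{i=1}^K\zeta\lambda_i\boldsymbol H_i .$$ Let $\Phi(\boldsymbol\lambda,\mu)$ be its infimum over $\boldsymbol Q\succeq 0$, $t_i\ge0$, $0\le\ell_i\le R_i$ (with $\ell_i=0$ if $t_i=0$). The dual problem is to maximize $\Phi(\boldsymbol\lambda,\mu)$ subject to $\boldsymbol F(\boldsymbol\lambda)\succeq 0$, $\mu\ge0$ and $\lambda_i\ge0$ for all $i$. **Statement.** Let $(\boldsymbol\lambda^{\rm opt},\mu^{\rm opt})$ be any optimal solution of the dual problem. With $W_0$ the principal branch of the Lambert $W$ function, put $$r_i^{\rm opt}=\frac{B}{\ln 2}\left(W_0\left(\frac{\tilde g_i}{\sigma^2e}\Big(\frac{\mu^{\rm opt}}{\lambda_i^{\rm opt}}+p_{c,i}\Big)-\frac1e\right)+1\right),\qquad \ell_i^{\rm opt}=\left[R_i-\sqrt{\frac{T^2}{3\kappa_iC_i^3}\left(\frac{\alpha}{\lambda_i^{\rm opt}}+\frac{\sigma^2\ln2}{B\tilde g_i}2^{r_i^{\rm opt}/B}\right)}\right]^+,\qquad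 t_i^{\rm opt}=\frac{\ell_i^{\rm opt}}{r_i^{\rm opt}}$$ if $\lambda_i^{\rm opt}>0$, and $\ell_i^{\rm opt}=t_i^{\rm opt}=0$ if $\lambda_i^{\rm opt}=0$. Put $f_i^{\rm opt}=C_i(R_i-\ell_i^{\rm opt})/T$ and suppose $f_i^{\rm opt}\le f_i^{\max}$ for all $i$ (for instance $C_iR_i\le Tf_i^{\max}$). Consider the semidefinite program $$\min_{\boldsymbol Q\succeq0}\ T\,\mathrm{tr}(\boldsymbol Q)\quad\text{s.t.}\quad \frac{\kappa_iC_i^3(R_i-\ell_i^{\rm opt})^3}{T^2}+\frac{t_i^{\rm opt}}{\tilde g_i}\beta(r_i^{\rm opt})+p_{c,i}t_i^{\rm opt}-T\zeta\,\mathrm{tr}(\boldsymbol Q\boldsymbol H_i)\le0\quad\text{for all } i,$$ where the term $\frac{t_i^{\rm opt}}{\tilde g_i}\beta(r_i^{\rm opt})$ is $0$ if $\lambda_i^{\rm opt}=0$. Then: 1. $r_i^{\rm opt}>0$ whenever $\lambda_i^{\rm opt}>0$, and the semidefinite program has an optimal solution. 2. For every optimal solution $\boldsymbol Q^{\rm opt}$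 of the semidefinite program, $\boldsymbol Q^{\rm opt}$, $\boldsymbol t^{\rm opt}$, $\boldsymbol\ell^{\rm opt}$ together with $f_{i,n}=f_i^{\rm opt}$ for all $i$ and all cycles $n$ in use form an optimal solution of (P1). 3. Conversely, every optimal solution $(\{f_{i,n}\},\boldsymbol Q,\boldsymbol t,\boldsymbol\ell)$ of (P1) satisfies: $\ell_i=\ell_i^{\rm opt}$ for all $i$; $t_i=t_i^{\rm opt}$ for all $i$ with $\lambda_i^{\rm opt}>0$, and for all $i$ if $\mu^{\rm opt}>0$; $f_{i,n}=f_i^{\rm opt}$ for all cycles $n$ in use of each user $i$ with $\lambda_i^{\rm opt}>0$; and $\boldsymbol Q$ is an optimal solution of the semidefinite program. -/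

import Mathlib

open scoped ComplexOrder

noncomputable section

/-- The principal branch of the Lambert function: the inverse of `w ↦ w * exp w` on `[-1, ∞)`.
It is meaningful for arguments `x ≥ -1/e`. -/
def lambertW0 (x : ℝ) : ℝ :=
  Function.invFunOn (fun w : ℝ => w * Real.exp w) (Set.Ici (-1)) x

/-- On `[-1/e, ∞)` the function `lambertW0` takes values `≥ -1` and solves `w * exp w = x`. -/
theorem lambertW0_spec {x : ℝ} (hx : -(1 / Real.exp 1) ≤ x) :
    -1 ≤ lambertW0 x ∧ lambertW0 x * Real.exp (lambertW0 x) = x := by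
  have hex : ∃ w ∈ Set.Ici (-1 : ℝ), (fun w : ℝ => w * Real.exp w) w = x := by
    have hle : (-1 : ℝ) ≤ max 0 x := le_trans (by norm_num) (le_max_left 0 x)
    have hc : ContinuousOn (fun w : ℝ => w * Real.exp w) (Set.Icc (-1) (max 0 x)) := by
      fun_prop
    have h1 : (fun w : ℝ => w * Real.exp w) (-1) ≤ x := by
      simpa [Real.exp_neg] using hx
    have h2 : x ≤ (fun w : ℝ => w * Real.exp w) (max 0 x) := by
      have h0 : (0 : ℝ) ≤ max 0 x := le_max_left 0 x
      have h3 : (1 : ℝ) ≤ Real.exp (max 0 x) := Real.one_le_exp h0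
      have h4 : x ≤ max 0 x := le_max_right 0 x
      simp only
      nlinarith
    obtain ⟨w, hw, hwx⟩ := intermediate_value_Icc hle hc ⟨h1, h2⟩
    exact ⟨w, hw.1, hwx⟩
  exact ⟨Function.invFunOn_mem hex, Function.invFunOn_eq hex⟩

/-- The sum `∑_{n=1}^{x} a_n` over a real number `x ≥ 0` of CPU cycles (the `n`-th cycle has
index `n - 1`): all completed cycles count fully, a last incomplete cycle counts with the fraction
of it that is executed. -/
def cycleSum (x : ℝ) (a : ℕ → ℝ) : ℝ :=
  ∑ n ∈ Finset.range ⌊x⌋₊, a n + (x - ⌊x⌋₊) * a ⌊x⌋₊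

/-- For an integer number of cycles this is the ordinary sum. -/
theorem cycleSum_natCast (m : ℕ) (a : ℕ → ℝ) :
    cycleSum (m : ℝ) a = ∑ n ∈ Finset.range m, a n := by
  simp [cycleSum]

/-- The data of a wireless powered mobile edge computing system with `K` users and an access
point (AP) with `N` antennas. -/
structure MECSystem (K N : ℕ) where
  /-- block length -/
  T : ℝ
  /-- energy harvesting efficiency -/
  ζ : ℝ
  /-- bandwidth -/
  B : ℝ
  /-- noise standard deviation; the noise power is `σ ^ 2` -/
  σ : ℝ
  /-- energy consumption of the AP per offloaded bit -/
  α : ℝ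
  /-- numbers of computation input bits -/
  R : Fin K → ℝ
  /-- CPU cycles per input bit -/
  C : Fin K → ℝ
  /-- effective capacitance coefficients -/
  κ : Fin K → ℝ
  /-- circuit powers -/
  pc : Fin K → ℝ
  /-- maximum CPU frequencies -/
  fmax : Fin K → ℝ
  /-- downlink channel vectors -/
  h : Fin K → EuclideanSpace ℂ (Fin N)
  /-- uplink channel vectors -/
  g : Fin K → EuclideanSpace ℂ (Fin N)
  T_pos : 0 < T
  ζ_pos : 0 < ζ
  ζ_le_one : ζ ≤ 1
  B_pos : 0 < B
  σ_pos : 0 < σ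
  α_pos : 0 < α
  R_pos : ∀ i, 0 < R i
  C_pos : ∀ i, 0 < C i
  κ_pos : ∀ i, 0 < κ i
  pc_pos : ∀ i, 0 < pc i
  g_ne_zero : ∀ i, g i ≠ 0

/-- The decision variables: energy covariance matrix, offloading times, offloaded bits and CPU
frequencies; `f i n` is the frequency of the cycle `n + 1` of user `i`. Only the entries `f i n`
with `n` smaller than the number of locally executed cycles are used. -/
structure MECDesign (K N : ℕ) where
  Q : Matrix (Fin N) (Fin N) ℂ
  t : Fin K → ℝ
  ell : Fin K → ℝ
  f : Fin K → ℕ → ℝ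

namespace MECSystem

variable {K N : ℕ} (S : MECSystem K N)

/-- The rank-one matrix `H_i = h_i h_iᴴ`. -/
def H (i : Fin K) : Matrix (Fin N) (Fin N) ℂ :=
  Matrix.vecMulVec (fun a => S.h i a) (fun a => star (S.h i a))

/-- The effective uplink channel power gain `‖g_i‖²`. -/
def gt (i : Fin K) : ℝ := ‖S.g i‖ ^ 2

/-- `β(x) = σ² (2^{x/B} - 1)`. -/
def β (x : ℝ) : ℝ := S.σ ^ 2 * ((2 : ℝ) ^ (x / S.B) - 1)

/-- Offloading energy `(t / g̃_i) β(ℓ / t) + p_{c,i} t` of user `i`. It vanishes for `t = 0`. -/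
def offloadEnergy (i : Fin K) (t ell : ℝ) : ℝ :=
  t / S.gt i * S.β (ell / t) + S.pc i * t

/-- Energy `T ζ tr(Q H_i)` harvested by user `i`. -/
def harvested (Q : Matrix (Fin N) (Fin N) ℂ) (i : Fin K) : ℝ :=
  S.T * S.ζ * (Matrix.trace (Q * S.H i)).re

/-- Number of CPU cycles that user `i` executes locally when it offloads `ell` bits. -/
def cycles (i : Fin K) (ell : ℝ) : ℝ := S.C i * (S.R i - ell)

/-- Local computing energy of user `i` for `ell` offloaded bits, when all its CPU cycles run at the
frequency `C_i (R_i - ℓ_i) / T`. -/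
def localEnergy (i : Fin K) (ell : ℝ) : ℝ :=
  S.κ i * S.C i ^ 3 * (S.R i - ell) ^ 3 / S.T ^ 2

/-- The constraints on times and bits of the single users: `t_i ≥ 0`, `0 ≤ ℓ_i ≤ R_i`, and
nothing is offloaded in zero time (since `ℓ_i = r_i t_i` with a rate `r_i`). -/
def Admissible (t ell : Fin K → ℝ) : Prop :=
  ∀ i, 0 ≤ t i ∧ 0 ≤ ell i ∧ ell i ≤ S.R i ∧ (t i = 0 → ell i = 0)

/-- Energy consumption at the AP, the objective of the problem (P1). -/
def objective (x : MECDesign K N) : ℝ :=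
  S.T * (Matrix.trace x.Q).re + ∑ i, S.α * x.ell i

/-- Feasible designs for the latency-constrained energy minimization problem (P1). -/
structure Feasible (x : MECDesign K N) : Prop where
  posSemidef : x.Q.PosSemidef
  latency : ∀ i, cycleSum (S.cycles i (x.ell i)) (fun n => 1 / x.f i n) ≤ S.T
  energy : ∀ i, cycleSum (S.cycles i (x.ell i)) (fun n => S.κ i * x.f i n ^ 2)
    + S.offloadEnergy i (x.t i) (x.ell i) - S.harvested x.Q i ≤ 0
  time : ∑ i, x.t i ≤ S.T
  admissible : S.Admissible x.t x.ell
  freq : ∀ (i : Fin K) (n : ℕ), (n : ℝ) < S.cycles i (x.ell i) → 0 < x.f i n ∧ x.f i n ≤ S.fmax i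

/-- Optimal solutions of the problem (P1). -/
def IsOptimal (x : MECDesign K N) : Prop :=
  S.Feasible x ∧ ∀ y : MECDesign K N, S.Feasible y → S.objective x ≤ S.objective y

/-- `F(λ) = I - ∑_i ζ λ_i H_i`. -/
def F (lam : Fin K → ℝ) : Matrix (Fin N) (Fin N) ℂ :=
  1 - ∑ i, ((S.ζ * lam i : ℝ) : ℂ) • S.H i

/-- Partial Lagrangian of the problem (P1.1), that is, of (P1) with all CPU frequencies of user
`i` equal to `C_i (R_i - ℓ_i) / T`; `lam i` belongs to the energy harvesting constraint of user `i`,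
`mu` to the constraint `∑ t_i ≤ T`. -/
def lagrangian (Q : Matrix (Fin N) (Fin N) ℂ) (t ell lam : Fin K → ℝ) (mu : ℝ) : ℝ :=
  S.T * (Matrix.trace (S.F lam * Q)).re - mu * S.T
    + ∑ i, (S.α * ell i + lam i * S.localEnergy i (ell i)
      + lam i * S.offloadEnergy i (t i) (ell i) + mu * t i)

/-- The dual function `Φ(λ, μ)`. -/
def dualFun (lam : Fin K → ℝ) (mu : ℝ) : EReal :=
  ⨅ (Q : Matrix (Fin N) (Fin N) ℂ) (t : Fin K → ℝ) (ell : Fin K → ℝ)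
    (_ : Q.PosSemidef ∧ S.Admissible t ell), ((S.lagrangian Q t ell lam mu : ℝ) : EReal)

/-- The feasible set of the dual problem (D1.1). -/
def DualFeasible (lam : Fin K → ℝ) (mu : ℝ) : Prop :=
  (S.F lam).PosSemidef ∧ 0 ≤ mu ∧ ∀ i, 0 ≤ lam i

/-- Optimal solutions `(λ, μ)` of the dual problem (D1.1). -/
def IsDualOptimal (lam : Fin K → ℝ) (mu : ℝ) : Prop :=
  S.DualFeasible lam mu ∧
    ∀ (lam' : Fin K → ℝ) (mu' : ℝ), S.DualFeasible lam' mu' →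
      S.dualFun lam' mu' ≤ S.dualFun lam mu

/-- The offloading rate `r_i` determined by the dual variables (used only where `lam i > 0`). -/
def rOpt (lam : Fin K → ℝ) (mu : ℝ) (i : Fin K) : ℝ :=
  S.B / Real.log 2 *
    (lambertW0 (S.gt i / (S.σ ^ 2 * Real.exp 1) * (mu / lam i + S.pc i) - 1 / Real.exp 1) + 1)

open Classical in
/-- The offloaded bits `ℓ_i` determined by the dual variables. -/
def ellOpt (lam : Fin K → ℝ) (mu : ℝ) (i : Fin K) : ℝ :=
  if 0 < lam i then
    max 0 (S.R i - Real.sqrt (S.T ^ 2 / (3 * S.κ i * S.C i ^ 3) *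
      (S.α / lam i + S.σ ^ 2 * Real.log 2 / (S.B * S.gt i) *
        (2 : ℝ) ^ (S.rOpt lam mu i / S.B))))
  else 0

open Classical in
/-- The offloading time `t_i` determined by the dual variables. -/
def tOpt (lam : Fin K → ℝ) (mu : ℝ) (i : Fin K) : ℝ :=
  if 0 < lam i then S.ellOpt lam mu i / S.rOpt lam mu i else 0

/-- The CPU frequency `C_i (R_i - ℓ_i) / T` determined by the dual variables. -/
def fOpt (lam : Fin K → ℝ) (mu : ℝ) (i : Fin K) : ℝ :=
  S.C i * (S.R i - S.ellOpt lam mu i) / S.T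

/-- Feasible points of the semidefinite program for the energy covariance matrix. -/
def SDPFeasible (lam : Fin K → ℝ) (mu : ℝ) (Q : Matrix (Fin N) (Fin N) ℂ) : Prop :=
  Q.PosSemidef ∧ ∀ i,
    S.κ i * S.C i ^ 3 * (S.R i - S.ellOpt lam mu i) ^ 3 / S.T ^ 2
      + S.tOpt lam mu i / S.gt i * S.β (S.rOpt lam mu i) + S.pc i * S.tOpt lam mu i
      - S.harvested Q i ≤ 0

/-- Optimal solutions of the semidefinite program: minimize `T tr(Q)`. -/
def IsSDPSolution (lam : Fin K → ℝ) (mu : ℝ) (Q : Matrix (Fin N) (Fin N) ℂ) : Prop :=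
  S.SDPFeasible lam mu Q ∧
    ∀ Q' : Matrix (Fin N) (Fin N) ℂ, S.SDPFeasible lam mu Q' →
      S.T * (Matrix.trace Q).re ≤ S.T * (Matrix.trace Q').re

end MECSystem

end

/-!
The proof compares (P1) with the convex problem in which the CPU of each user runs at the constant
frequency that exhausts the block length, and obtains the optimum of the latter by Lagrangian
duality.

* *Constant frequencies.* By `f² + 2c³/f ≥ 3c²`, with equality only at `f = c`, a constant frequency
  needs the least energy for a given number of cycles and a given time (`cycleSum_sq_ge`). So every
  feasible design of (P1) is feasible for the constant-frequency problem, and the difference shows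
  up as slack in the energy constraint.
* *Tangent planes.* The offloading energy `(t / g̃) β(ℓ / t) + p t` is a perspective function, hence
  the supremum of its tangent planes along the rays `ℓ = r t` (`offloadEnergy_le_iff`). This makes
  the energy constraint closed and convex in spite of the discontinuity at `t = 0`, and it also
  gives the minimizers of the Lagrangian.
* *Strong duality.* The constant-frequency problem attains its minimum, by compactness
  (`exists_constFreq_minimizer`), and separation of convex sets together with a Slater point gives
  dual variables whose dual value is at least this minimum (`exists_dual_ge`). A Slater point
  exists because a dual optimum rules out zero downlink channels (`IsDualOptimal.h_ne_zero`).
* *Uniqueness.* Hence each solution of the constant-frequency problem minimizes the Lagrangian at the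
  given dual optimum. The Lagrangian splits over the users. For `λ_i > 0` the Lambert function
  yields the rate at which the tangent plane has slope `-μ / λ_i` in `t` (`rOpt_spec`); what remains
  is a strictly convex cubic in `ℓ` (`eq_ellOpt_of_le`). For `λ_i = 0` the share of the user is
  `α ℓ + μ t`.

So `ℓ` is known, the cost differs from the objective of the semidefinite program by a constant, and
complementary slackness for `λ_i > 0` forces the frequencies to be constant.
-/

/-! ### Sums over fractional numbers of cycles -/

theorem cycleSum_congr {x : ℝ} (hx : 0 ≤ x) {a b : ℕ → ℝ} (h : ∀ n : ℕ, (n : ℝ) < x → a n = b n) :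
    cycleSum x a = cycleSum x b := by
  have hfl := Nat.floor_le hx
  unfold cycleSum
  congr 1
  · refine Finset.sum_congr rfl fun n hn => h n ?_
    have : (n : ℝ) < ⌊x⌋₊ := by exact_mod_cast Finset.mem_range.1 hn
    linarith
  · rcases hfl.eq_or_lt with h0 | h0
    · rw [h0]; simp
    · rw [h _ h0]

theorem cycleSum_const (x c : ℝ) : cycleSum x (fun _ => c) = x * c := by
  simp [cycleSum]; ring

theorem cycleSum_add (x : ℝ) (a b : ℕ → ℝ) :
    cycleSum x (fun n => a n + b n) = cycleSum x a + cycleSum x b := by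
  simp only [cycleSum, Finset.sum_add_distrib]; ring

theorem cycleSum_const_mul (x c : ℝ) (a : ℕ → ℝ) :
    cycleSum x (fun n => c * a n) = c * cycleSum x a := by
  simp only [cycleSum, ← Finset.mul_sum]; ring

theorem cycleSum_nonneg {x : ℝ} (hx : 0 ≤ x) {d : ℕ → ℝ} (h : ∀ n : ℕ, (n : ℝ) < x → 0 ≤ d n) :
    0 ≤ cycleSum x d := by
  have hfl := Nat.floor_le hx
  refine add_nonneg (Finset.sum_nonneg fun n hn => h n ?_) ?_
  · have : (n : ℝ) < ⌊x⌋₊ := by exact_mod_cast Finset.mem_range.1 hn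
    linarith
  · rcases hfl.eq_or_lt with h0 | h0
    · rw [h0]; simp
    · exact mul_nonneg (by linarith) (h _ h0)

theorem eq_zero_of_cycleSum_le_zero {x : ℝ} (hx : 0 ≤ x) {d : ℕ → ℝ}
    (h : ∀ n : ℕ, (n : ℝ) < x → 0 ≤ d n) (hs : cycleSum x d ≤ 0) {n : ℕ} (hn : (n : ℝ) < x) :
    d n = 0 := by
  have hfl := Nat.floor_le hx
  have hlt : ∀ m ∈ Finset.range ⌊x⌋₊, 0 ≤ d m := fun m hm => h m <| by
    have : (m : ℝ) < ⌊x⌋₊ := by exact_mod_cast Finset.mem_range.1 hm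
    linarith
  have h1 : 0 ≤ ∑ m ∈ Finset.range ⌊x⌋₊, d m := Finset.sum_nonneg hlt
  have h2 : 0 ≤ (x - ⌊x⌋₊) * d ⌊x⌋₊ := by
    rcases hfl.eq_or_lt with h0 | h0
    · rw [h0]; simp
    · exact mul_nonneg (by linarith) (h _ h0)
  unfold cycleSum at hs
  rcases (Nat.le_floor hn.le).eq_or_lt with h0 | h0
  · have h3 : (x - ⌊x⌋₊) * d ⌊x⌋₊ = 0 := by linarith
    rw [← h0] at h3
    exact (mul_eq_zero.1 h3).resolve_left (by linarith)
  · exact (Finset.sum_eq_zero_iff_of_nonneg hlt).1 (by linarith) n (Finset.mem_range.2 h0)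

/-- The pointwise bound `f² + 2c³/f ≥ 3c²` (arithmetic-geometric mean), with equality only for
`f = c`, summed over the cycles for `c = x / T`: among all frequency profiles that finish `x` cycles
within the time `T`, the constant one needs the least energy, and no other one does. -/
theorem cycleSum_sq_ge {x T : ℝ} (hx : 0 ≤ x) (hT : 0 < T) {f : ℕ → ℝ}
    (hf : ∀ n : ℕ, (n : ℝ) < x → 0 < f n) (hlat : cycleSum x (fun n => 1 / f n) ≤ T) :
    x ^ 3 / T ^ 2 ≤ cycleSum x (fun n => f n ^ 2) ∧
      (cycleSum x (fun n => f n ^ 2) ≤ x ^ 3 / T ^ 2 →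
        ∀ n : ℕ, (n : ℝ) < x → f n = x / T) := by
  set c := x / T with hc
  have hc0 : 0 ≤ c := by positivity
  have hxc : x = c * T := by rw [hc]; field_simp
  have hval : x ^ 3 / T ^ 2 = x * c ^ 2 := by rw [hc]; field_simp
  have hsplit : cycleSum x (fun n => (f n ^ 2 + 2 * c ^ 3 * (1 / f n)) + -3 * c ^ 2)
      = cycleSum x (fun n => f n ^ 2) + 2 * c ^ 3 * cycleSum x (fun n => 1 / f n)
        - 3 * c ^ 2 * x := by
    rw [cycleSum_add, cycleSum_add, cycleSum_const_mul, cycleSum_const]; ring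
  have hgap : ∀ n : ℕ, (n : ℝ) < x →
      (f n ^ 2 + 2 * c ^ 3 * (1 / f n)) + -3 * c ^ 2 = (f n - c) ^ 2 * (f n + 2 * c) / f n := by
    intro n hn
    have := (hf n hn).ne'
    field_simp
    ring
  have hd : ∀ n : ℕ, (n : ℝ) < x → 0 ≤ (f n ^ 2 + 2 * c ^ 3 * (1 / f n)) + -3 * c ^ 2 := by
    intro n hn
    have := hf n hn
    rw [hgap n hn]
    positivity
  have hmul : 2 * c ^ 3 * cycleSum x (fun n => 1 / f n) ≤ 2 * c ^ 2 * x := by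
    calc _ ≤ 2 * c ^ 3 * T := mul_le_mul_of_nonneg_left hlat (by positivity)
      _ = 2 * c ^ 2 * x := by rw [hxc]; ring
  rw [hval]
  refine ⟨?_, fun hle n hn => ?_⟩
  · have := cycleSum_nonneg hx hd
    rw [hsplit] at this
    nlinarith
  · have h0 := eq_zero_of_cycleSum_le_zero hx hd (by rw [hsplit]; nlinarith) hn
    rw [hgap n hn] at h0
    have hfn := hf n hn
    have h1 : (f n - c) ^ 2 = 0 := by
      rcases div_eq_zero_iff.1 h0 with h | h
      · exact (mul_eq_zero.1 h).resolve_right (by positivity)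
      · exact absurd h hfn.ne'
    linarith [pow_eq_zero_iff (two_ne_zero) |>.1 h1]

namespace MECSystem

variable {K N : ℕ} (S : MECSystem K N)

/-! ### Offloading energy and its tangents -/

theorem gt_pos (i : Fin K) : 0 < S.gt i := by
  have := norm_pos_iff.2 (S.g_ne_zero i)
  unfold gt; positivity

/-- The slope `β'(r) / g̃_i` in `ℓ` of the tangent plane to the offloading energy along the ray
`ℓ = r t`. -/
noncomputable def offSlope (i : Fin K) (r : ℝ) : ℝ :=
  S.σ ^ 2 * Real.log 2 / (S.B * S.gt i) * (2 : ℝ) ^ (r / S.B)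

/-- The slope `(β(r) - r β'(r)) / g̃_i + p_{c,i}` in `t` of the tangent plane to the offloading
energy along the ray `ℓ = r t`. The plane passes through the origin. -/
noncomputable def timeSlope (i : Fin K) (r : ℝ) : ℝ :=
  S.β r / S.gt i + S.pc i - S.offSlope i r * r

theorem offSlope_pos (i : Fin K) (r : ℝ) : 0 < S.offSlope i r := by
  have := S.gt_pos i
  have := S.σ_pos
  have := S.B_pos
  have := Real.log_pos (one_lt_two)
  unfold offSlope
  positivity

/-- The excess of the offloading energy over a tangent plane comes from `exp y ≥ 1 + y`. -/
theorem offloadEnergy_sub_tangent (i : Fin K) {t : ℝ} (ht : 0 < t) (ell r : ℝ) :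
    S.offloadEnergy i t ell - (S.offSlope i r * ell + S.timeSlope i r * t) =
      t / S.gt i * S.σ ^ 2 * (2 : ℝ) ^ (r / S.B) *
        (Real.exp (Real.log 2 * (ell / t - r) / S.B) - (Real.log 2 * (ell / t - r) / S.B + 1)) := by
  have hg := (S.gt_pos i).ne'
  have hB := S.B_pos.ne'
  have h2 : (2 : ℝ) ^ (ell / t / S.B) =
      (2 : ℝ) ^ (r / S.B) * Real.exp (Real.log 2 * (ell / t - r) / S.B) := by
    rw [Real.rpow_def_of_pos two_pos, Real.rpow_def_of_pos two_pos, ← Real.exp_add]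
    congr 1; field_simp; ring
  unfold offloadEnergy timeSlope offSlope β
  rw [h2]
  field_simp
  ring

theorem offloadEnergy_zero (i : Fin K) (ell : ℝ) : S.offloadEnergy i 0 ell = 0 := by
  simp [offloadEnergy]

theorem tangent_le_offloadEnergy (i : Fin K) {t ell : ℝ} (ht : 0 ≤ t) (h0 : t = 0 → ell = 0)
    (r : ℝ) : S.offSlope i r * ell + S.timeSlope i r * t ≤ S.offloadEnergy i t ell := by
  rcases ht.eq_or_lt with h | h
  · subst h; simp [h0 rfl, offloadEnergy_zero]
  · have hg := S.gt_pos i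
    have := S.σ_pos
    have h1 := Real.add_one_le_exp (Real.log 2 * (ell / t - r) / S.B)
    have h2 := S.offloadEnergy_sub_tangent i h ell r
    have h3 : 0 ≤ S.offloadEnergy i t ell - (S.offSlope i r * ell + S.timeSlope i r * t) := by
      rw [h2]; exact mul_nonneg (by positivity) (by linarith)
    linarith

theorem offloadEnergy_eq_tangent (i : Fin K) {t : ℝ} (ht : 0 < t) (ell : ℝ) :
    S.offloadEnergy i t ell = S.offSlope i (ell / t) * ell + S.timeSlope i (ell / t) * t := by
  have := S.offloadEnergy_sub_tangent i ht ell (ell / t)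
  simp at this
  linarith

theorem eq_mul_of_offloadEnergy_le (i : Fin K) {t ell : ℝ} (ht : 0 ≤ t) (h0 : t = 0 → ell = 0)
    {r : ℝ} (h : S.offloadEnergy i t ell ≤ S.offSlope i r * ell + S.timeSlope i r * t) :
    ell = r * t := by
  rcases ht.eq_or_lt with h1 | h1
  · subst h1; simp [h0 rfl]
  · by_contra hne
    have hg := S.gt_pos i
    have := S.σ_pos
    have hB := S.B_pos
    have hlog := Real.log_pos (one_lt_two)
    have hne' : Real.log 2 * (ell / t - r) / S.B ≠ 0 := by
      have h3 : ell / t - r ≠ 0 := by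
        intro h4; apply hne
        have : ell / t = r := by linarith
        rw [← this]; field_simp
      exact div_ne_zero (mul_ne_zero hlog.ne' h3) hB.ne'
    have h1' := Real.add_one_lt_exp hne'
    have h2 := S.offloadEnergy_sub_tangent i h1 ell r
    have h3 : 0 < S.offloadEnergy i t ell - (S.offSlope i r * ell + S.timeSlope i r * t) := by
      rw [h2]; exact mul_pos (by positivity) (by linarith)
    linarith

theorem offloadEnergy_nonneg (i : Fin K) {t ell : ℝ} (ht : 0 ≤ t) (hl : 0 ≤ ell) :
    0 ≤ S.offloadEnergy i t ell := by
  have hg := S.gt_pos i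
  have hp := S.pc_pos i
  have hB := S.B_pos
  have hb : 0 ≤ S.β (ell / t) :=
    mul_nonneg (sq_nonneg _)
      (sub_nonneg.2 (Real.one_le_rpow one_le_two (by positivity)))
  unfold offloadEnergy; positivity

theorem tendsto_offSlope (i : Fin K) :
    Filter.Tendsto (S.offSlope i) Filter.atTop Filter.atTop := by
  have hg := S.gt_pos i
  have := S.σ_pos
  have hB := S.B_pos
  have hlog := Real.log_pos (one_lt_two)
  refine Filter.Tendsto.const_mul_atTop (by positivity) ?_
  exact (tendsto_rpow_atTop_of_base_gt_one 2 one_lt_two).comp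
    (Filter.tendsto_id.atTop_div_const hB)

/-- The offloading energy is the supremum of its tangent planes. The right-hand side also encodes
that nothing is offloaded in zero time, because `offSlope` is unbounded; so it is a closed and
convex condition although the offloading energy is discontinuous at the origin. -/
theorem offloadEnergy_le_iff (i : Fin K) {t ell c : ℝ} (ht : 0 ≤ t) (hl : 0 ≤ ell) :
    ((t = 0 → ell = 0) ∧ S.offloadEnergy i t ell ≤ c) ↔
      ∀ r, S.offSlope i r * ell + S.timeSlope i r * t ≤ c := by
  refine ⟨fun h r => (S.tangent_le_offloadEnergy i ht h.1 r).trans h.2, fun h => ?_⟩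
  rcases ht.eq_or_lt with h1 | h1
  · subst h1
    have h0 : ell = 0 := by
      by_contra hne
      have hpos : 0 < ell := lt_of_le_of_ne hl (Ne.symm hne)
      obtain ⟨r, hr⟩ := ((S.tendsto_offSlope i).eventually_gt_atTop (c / ell)).exists
      have := h r
      rw [div_lt_iff₀ hpos] at hr
      linarith
    have := h 0
    refine ⟨fun _ => h0, ?_⟩
    rw [offloadEnergy_zero]; simp [h0] at this; exact this
  · refine ⟨fun h2 => absurd h2 h1.ne', ?_⟩
    rw [S.offloadEnergy_eq_tangent i h1]; exact h _

/-! ### Local computing energy -/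

theorem localCoeff_pos (i : Fin K) : 0 < S.κ i * S.C i ^ 3 / S.T ^ 2 := by
  have := S.κ_pos i
  have := S.C_pos i
  have := S.T_pos
  positivity

theorem localEnergy_eq (i : Fin K) (ell : ℝ) :
    S.localEnergy i ell = S.κ i * S.C i ^ 3 / S.T ^ 2 * (S.R i - ell) ^ 3 := by
  unfold localEnergy; ring

theorem localEnergy_nonneg (i : Fin K) {ell : ℝ} (h : ell ≤ S.R i) : 0 ≤ S.localEnergy i ell := by
  rw [localEnergy_eq]
  exact mul_nonneg (S.localCoeff_pos i).le (pow_nonneg (by linarith) 3)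

theorem continuous_localEnergy (i : Fin K) : Continuous (S.localEnergy i) := by
  unfold localEnergy; fun_prop

theorem convexOn_localEnergy (i : Fin K) : ConvexOn ℝ (Set.Iic (S.R i)) (S.localEnergy i) := by
  refine ⟨convex_Iic _, fun x hx y hy a b ha hb hab => ?_⟩
  have h := (convexOn_pow (𝕜 := ℝ) 3).2 (x := S.R i - x) (y := S.R i - y)
    (Set.mem_Ici.2 (sub_nonneg.2 hx)) (Set.mem_Ici.2 (sub_nonneg.2 hy)) ha hb hab
  simp only [localEnergy_eq, smul_eq_mul] at h ⊢
  have h1 : S.R i - (a * x + b * y) = a * (S.R i - x) + b * (S.R i - y) := by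
    linear_combination -S.R i * hab
  rw [h1]
  have := mul_le_mul_of_nonneg_left h (S.localCoeff_pos i).le
  linarith

end MECSystem

/-! ### Positive semidefinite matrices -/

open scoped MatrixOrder Matrix.Norms.L2Operator in
theorem Matrix.PosSemidef.exists_eq_conjTranspose_mul_self {n : Type*} [Fintype n]
    [DecidableEq n] {Q : Matrix n n ℂ} (hQ : Q.PosSemidef) :
    ∃ A : Matrix n n ℂ, Q = A.conjTranspose * A :=
  CStarAlgebra.nonneg_iff_eq_star_mul_self.mp hQ.nonneg

theorem Matrix.re_trace_conjTranspose_mul_self {m n : Type*} [Fintype m] [Fintype n]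
    (A : Matrix m n ℂ) :
    (Matrix.trace (A.conjTranspose * A)).re = ∑ j, ∑ i, ‖A i j‖ ^ 2 := by
  simp only [Matrix.trace, Matrix.diag, Matrix.mul_apply, Matrix.conjTranspose_apply,
    Complex.re_sum]
  refine Finset.sum_congr rfl fun j _ => Finset.sum_congr rfl fun i _ => ?_
  rw [Complex.star_def, ← Complex.normSq_eq_conj_mul_self, Complex.ofReal_re,
    Complex.normSq_eq_norm_sq]

theorem Matrix.norm_sq_le_re_trace_conjTranspose_mul_self {m n : Type*} [Fintype m] [Fintype n]
    (A : Matrix m n ℂ) (i : m) (j : n) :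
    ‖A i j‖ ^ 2 ≤ (Matrix.trace (A.conjTranspose * A)).re := by
  rw [Matrix.re_trace_conjTranspose_mul_self]
  calc ‖A i j‖ ^ 2 ≤ ∑ i, ‖A i j‖ ^ 2 :=
        Finset.single_le_sum (f := fun i => ‖A i j‖ ^ 2) (fun _ _ => by positivity)
          (Finset.mem_univ i)
    _ ≤ _ := Finset.single_le_sum (f := fun j => ∑ i, ‖A i j‖ ^ 2) (fun _ _ => by positivity)
          (Finset.mem_univ j)

theorem Matrix.PosSemidef.re_trace_nonneg {n : Type*} [Fintype n] {Q : Matrix n n ℂ}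
    (hQ : Q.PosSemidef) : 0 ≤ (Matrix.trace Q).re :=
  (Complex.nonneg_iff.1 hQ.trace_nonneg).1

theorem isCompact_setOf_norm_entry_le {m n : Type*} (M : ℝ) :
    IsCompact {A : Matrix m n ℂ | ∀ i j, ‖A i j‖ ≤ M} := by
  have h : {A : Matrix m n ℂ | ∀ i j, ‖A i j‖ ≤ M} =
      Set.univ.pi fun _ : m => Set.univ.pi fun _ : n => Metric.closedBall (0 : ℂ) M := by
    ext A
    refine ⟨fun h i _ j _ => ?_, fun h i j => ?_⟩
    · simpa using h i j
    · simpa using h i trivial j trivial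
  rw [h]
  exact isCompact_univ_pi fun _ => isCompact_univ_pi fun _ => isCompact_closedBall _ _

namespace MECSystem

variable {K N : ℕ} (S : MECSystem K N)

/-! ### The problem with constant frequencies -/

theorem harvested_add (Q Q' : Matrix (Fin N) (Fin N) ℂ) (i : Fin K) :
    S.harvested (Q + Q') i = S.harvested Q i + S.harvested Q' i := by
  simp [harvested, add_mul]; ring

theorem harvested_smul (c : ℝ) (Q : Matrix (Fin N) (Fin N) ℂ) (i : Fin K) :
    S.harvested (c • Q) i = c * S.harvested Q i := by
  simp [harvested]; ring

theorem harvested_one (i : Fin K) :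
    S.harvested 1 i = S.T * S.ζ * ‖S.h i‖ ^ 2 := by
  rw [EuclideanSpace.norm_sq_eq]
  simp only [harvested, one_mul, H, Matrix.trace_vecMulVec, dotProduct, Complex.re_sum]
  congr 1
  refine Finset.sum_congr rfl fun a _ => ?_
  rw [mul_comm, Complex.star_def, ← Complex.normSq_eq_conj_mul_self, Complex.ofReal_re,
    Complex.normSq_eq_norm_sq]

/-- The objective of (P1) as a function of the covariance matrix and the offloaded bits. -/
noncomputable def cost (Q : Matrix (Fin N) (Fin N) ℂ) (ell : Fin K → ℝ) : ℝ :=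
  S.T * (Matrix.trace Q).re + ∑ i, S.α * ell i

/-- The energy consumption minus the harvested energy of user `i` when its CPU runs at constant
frequency. -/
noncomputable def netEnergy (Q : Matrix (Fin N) (Fin N) ℂ) (t ell : Fin K → ℝ) (i : Fin K) : ℝ :=
  S.localEnergy i (ell i) + S.offloadEnergy i (t i) (ell i) - S.harvested Q i

/-- Feasible points of (P1) with the CPU of each user at the constant frequency that exhausts the
block length, and without the bounds on the frequencies. -/
structure ConstFreqFeasible (Q : Matrix (Fin N) (Fin N) ℂ) (t ell : Fin K → ℝ) : Prop where
  posSemidef : Q.PosSemidef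
  energy : ∀ i, S.netEnergy Q t ell i ≤ 0
  time : ∑ i, t i ≤ S.T
  admissible : S.Admissible t ell

theorem admissible_zero : S.Admissible 0 0 := fun i => by simp [(S.R_pos i).le]

/-- A Slater point: isotropic transmission with enough power and no offloading. -/
theorem exists_strictly_feasible (hh : ∀ i, S.h i ≠ 0) :
    ∃ Q : Matrix (Fin N) (Fin N) ℂ, Q.PosSemidef ∧ ∀ i, S.netEnergy Q 0 0 i < 0 := by
  have hTp := S.T_pos
  have hζp := S.ζ_pos
  have hnp : ∀ i, 0 < S.T * S.ζ * ‖S.h i‖ ^ 2 := fun i => by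
    have := norm_pos_iff.2 (hh i)
    positivity
  have hloc : ∀ i, 0 ≤ S.localEnergy i 0 := fun i => S.localEnergy_nonneg i (S.R_pos i).le
  set c : ℝ := 1 + ∑ i, S.localEnergy i 0 / (S.T * S.ζ * ‖S.h i‖ ^ 2) with hc
  have hterm : ∀ i, S.localEnergy i 0 / (S.T * S.ζ * ‖S.h i‖ ^ 2) < c := fun i => by
    have := Finset.single_le_sum
      (f := fun i => S.localEnergy i 0 / (S.T * S.ζ * ‖S.h i‖ ^ 2))
      (fun i _ => div_nonneg (hloc i) (hnp i).le) (Finset.mem_univ i)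
    linarith
  have hc0 : 0 ≤ c := add_nonneg zero_le_one
    (Finset.sum_nonneg fun i _ => div_nonneg (hloc i) (hnp i).le)
  refine ⟨c • 1, Matrix.PosSemidef.one.smul hc0, fun i => ?_⟩
  have h1 := hterm i
  rw [div_lt_iff₀ (hnp i)] at h1
  simp only [netEnergy, Pi.zero_apply, harvested_smul, harvested_one, offloadEnergy_zero]
  linarith

/-- Writing `Q = Aᴴ A` and using the tangent planes for the offloading energy, the points that are
no worse than a Slater point form a compact set. -/
theorem exists_constFreq_minimizer (hh : ∀ i, S.h i ≠ 0) :
    ∃ Q t ell, S.ConstFreqFeasible Q t ell ∧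
      ∀ Q' t' ell', S.ConstFreqFeasible Q' t' ell' → S.cost Q ell ≤ S.cost Q' ell' := by
  have hT := S.T_pos
  obtain ⟨Q₀, hQ₀, hs₀⟩ := S.exists_strictly_feasible hh
  have hfeas₀ : S.ConstFreqFeasible Q₀ 0 0 :=
    ⟨hQ₀, fun i => (hs₀ i).le, by simpa using hT.le, S.admissible_zero⟩
  set c₀ := S.cost Q₀ 0 with hc₀
  set M := Real.sqrt (c₀ / S.T) with hM
  let q : Matrix (Fin N) (Fin N) ℂ → Matrix (Fin N) (Fin N) ℂ := fun A => A.conjTranspose * A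
  have hq : Continuous q := by fun_prop
  have hharv : ∀ i, Continuous fun A => S.harvested (q A) i := fun i => by
    unfold harvested
    exact continuous_const.mul
      (Complex.continuous_re.comp (Continuous.matrix_trace (hq.matrix_mul continuous_const)))
  let 𝒦 : Set (Matrix (Fin N) (Fin N) ℂ × (Fin K → ℝ) × (Fin K → ℝ)) :=
    ({A | ∀ i j, ‖A i j‖ ≤ M} ×ˢ Set.Icc 0 (fun _ => S.T) ×ˢ Set.Icc 0 S.R) ∩
      ({p | ∑ i, p.2.1 i ≤ S.T} ∩ {p | ∀ i r, S.offSlope i r * p.2.2 i + S.timeSlope i r * p.2.1 i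
        ≤ S.harvested (q p.1) i - S.localEnergy i (p.2.2 i)})
  have hcomp : IsCompact 𝒦 := by
    refine ((isCompact_setOf_norm_entry_le M).prod (isCompact_Icc.prod isCompact_Icc)).inter_right
      (IsClosed.inter (isClosed_le (by fun_prop) continuous_const) ?_)
    simp only [Set.ofPred_forall]
    refine isClosed_iInter fun i => isClosed_iInter fun r => isClosed_le (by fun_prop) ?_
    exact ((hharv i).comp continuous_fst).sub ((S.continuous_localEnergy i).comp (by fun_prop))
  have hmem : ∀ A t ell, (A, t, ell) ∈ 𝒦 → S.ConstFreqFeasible (q A) t ell := by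
    rintro A t ell ⟨⟨-, ht, hl⟩, hsum, hen⟩
    have key : ∀ i, (t i = 0 → ell i = 0) ∧
        S.offloadEnergy i (t i) (ell i) ≤ S.harvested (q A) i - S.localEnergy i (ell i) :=
      fun i => (S.offloadEnergy_le_iff i (ht.1 i) (hl.1 i)).2 (hen i)
    refine ⟨Matrix.posSemidef_conjTranspose_mul_self A, fun i => ?_, hsum, fun i =>
      ⟨ht.1 i, hl.1 i, hl.2 i, (key i).1⟩⟩
    have := (key i).2
    unfold netEnergy
    linarith
  have hmem' : ∀ A t ell, S.ConstFreqFeasible (q A) t ell → S.cost (q A) ell ≤ c₀ →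
      (A, t, ell) ∈ 𝒦 := by
    intro A t ell hf hle
    refine ⟨⟨fun i j => ?_, ⟨fun i => (hf.admissible i).1, fun i => ?_⟩,
      ⟨fun i => (hf.admissible i).2.1, fun i => (hf.admissible i).2.2.1⟩⟩, hf.time, fun i => ?_⟩
    · have h1 := Matrix.norm_sq_le_re_trace_conjTranspose_mul_self A i j
      have h2 : 0 ≤ ∑ i, S.α * ell i :=
        Finset.sum_nonneg fun i _ => mul_nonneg S.α_pos.le (hf.admissible i).2.1
      have h3 : S.T * (Matrix.trace (q A)).re ≤ c₀ := by unfold cost at hle; linarith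
      refine Real.le_sqrt_of_sq_le (h1.trans ?_)
      rw [le_div_iff₀ hT]
      linarith
    · exact (Finset.single_le_sum (f := t) (fun i _ => (hf.admissible i).1)
        (Finset.mem_univ i)).trans hf.time
    · refine (S.offloadEnergy_le_iff i (hf.admissible i).1 (hf.admissible i).2.1).1
        ⟨(hf.admissible i).2.2.2, ?_⟩
      have := hf.energy i
      unfold netEnergy at this
      simp only
      linarith
  obtain ⟨A₀, hA₀⟩ := hQ₀.exists_eq_conjTranspose_mul_self
  have hne : 𝒦.Nonempty := ⟨(A₀, 0, 0), hmem' A₀ 0 0 (by simpa [q, ← hA₀] using hfeas₀)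
    (by simp [q, ← hA₀, hc₀])⟩
  have hcont : Continuous fun p : Matrix (Fin N) (Fin N) ℂ × (Fin K → ℝ) × (Fin K → ℝ) =>
      S.cost (q p.1) p.2.2 := by
    unfold cost
    refine Continuous.add (continuous_const.mul
      (Complex.continuous_re.comp (Continuous.matrix_trace (hq.comp continuous_fst)))) (by fun_prop)
  obtain ⟨⟨A, t, ell⟩, hp, hmin⟩ := hcomp.exists_isMinOn hne hcont.continuousOn
  refine ⟨q A, t, ell, hmem A t ell hp, fun Q' t' ell' hf => ?_⟩
  obtain ⟨A', hA'⟩ := hf.posSemidef.exists_eq_conjTranspose_mul_self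
  rcases le_total (S.cost Q' ell') c₀ with hle | hle
  · have : (A', t', ell') ∈ 𝒦 := hmem' A' t' ell' (by simpa [q, ← hA'] using hf)
      (by simpa [q, ← hA'] using hle)
    simpa [q, ← hA'] using hmin this
  · refine le_trans ?_ hle
    have : (A₀, 0, 0) ∈ 𝒦 := hmem' A₀ 0 0 (by simpa [q, ← hA₀] using hfeas₀)
      (by simp [q, ← hA₀, hc₀])
    simpa [q, ← hA₀, hc₀] using hmin this

/-! ### The dual function -/

theorem isHermitian_H (i : Fin K) : (S.H i).IsHermitian :=
  (Matrix.posSemidef_vecMulVec_self_star (fun a => S.h i a)).isHermitian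

theorem isHermitian_F (lam : Fin K → ℝ) : (S.F lam).IsHermitian := by
  unfold F Matrix.IsHermitian
  simp only [Matrix.conjTranspose_sub, Matrix.conjTranspose_one, Matrix.conjTranspose_sum,
    Matrix.conjTranspose_smul, (S.isHermitian_H _).eq, Complex.star_def, Complex.conj_ofReal]

theorem re_trace_F_mul (lam : Fin K → ℝ) (Q : Matrix (Fin N) (Fin N) ℂ) :
    S.T * (Matrix.trace (S.F lam * Q)).re =
      S.T * (Matrix.trace Q).re - ∑ i, lam i * S.harvested Q i := by
  have h : ∀ i, lam i * S.harvested Q i =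
      S.T * (Matrix.trace ((((S.ζ * lam i : ℝ) : ℂ) • S.H i) * Q)).re := fun i => by
    rw [Matrix.smul_mul, Matrix.trace_smul, Matrix.trace_mul_comm (S.H i), smul_eq_mul,
      Complex.re_ofReal_mul]
    unfold harvested; ring
  simp only [h, F, sub_mul, one_mul, Finset.sum_mul, Matrix.trace_sub, Matrix.trace_sum,
    Complex.sub_re, Complex.re_sum, mul_sub, Finset.mul_sum]

/-- The partial Lagrangian in the usual form: cost plus weighted constraint functions. -/
theorem lagrangian_eq (Q : Matrix (Fin N) (Fin N) ℂ) (t ell lam : Fin K → ℝ) (mu : ℝ) :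
    S.lagrangian Q t ell lam mu =
      S.cost Q ell + ∑ i, lam i * S.netEnergy Q t ell i + mu * (∑ i, t i - S.T) := by
  unfold lagrangian cost netEnergy
  rw [re_trace_F_mul]
  simp only [mul_sub, mul_add, Finset.sum_add_distrib, Finset.sum_sub_distrib, Finset.mul_sum]
  ring

theorem dualFun_le (lam : Fin K → ℝ) (mu : ℝ) {Q : Matrix (Fin N) (Fin N) ℂ} {t ell : Fin K → ℝ}
    (hQ : Q.PosSemidef) (ha : S.Admissible t ell) :
    S.dualFun lam mu ≤ (S.lagrangian Q t ell lam mu : ℝ) :=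
  iInf_le_of_le Q <| iInf_le_of_le t <| iInf_le_of_le ell <| iInf_le_of_le ⟨hQ, ha⟩ le_rfl

theorem le_dualFun (lam : Fin K → ℝ) (mu : ℝ) {c : ℝ}
    (h : ∀ Q t ell, Matrix.PosSemidef Q → S.Admissible t ell →
      c ≤ S.lagrangian Q t ell lam mu) : (c : EReal) ≤ S.dualFun lam mu :=
  le_iInf fun Q => le_iInf fun t => le_iInf fun ell => le_iInf fun hp =>
    EReal.coe_le_coe_iff.2 (h Q t ell hp.1 hp.2)

theorem exists_pos_le_energy (i : Fin K) : ∃ m : ℝ, 0 < m ∧ ∀ t ell : ℝ, 0 ≤ t → 0 ≤ ell →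
    ell ≤ S.R i → (t = 0 → ell = 0) → m ≤ S.localEnergy i ell + S.offloadEnergy i t ell := by
  have hR := S.R_pos i
  have ha := S.localCoeff_pos i
  have hs := S.offSlope_pos i 0
  refine ⟨min (S.κ i * S.C i ^ 3 / S.T ^ 2 * (S.R i / 2) ^ 3) (S.offSlope i 0 * (S.R i / 2)),
    by positivity, fun t ell ht hl hlR h0 => ?_⟩
  have h1 := S.tangent_le_offloadEnergy i ht h0 0
  have h2 : 0 ≤ S.timeSlope i 0 * t := by
    have : S.timeSlope i 0 = S.pc i := by simp [timeSlope, β]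
    rw [this]; exact mul_nonneg (S.pc_pos i).le ht
  rcases le_total ell (S.R i / 2) with h | h
  · refine (min_le_left _ _).trans ?_
    have h3 : (S.R i / 2) ^ 3 ≤ (S.R i - ell) ^ 3 := by gcongr; linarith
    have h4 := mul_le_mul_of_nonneg_left h3 ha.le
    rw [localEnergy_eq]
    have := mul_nonneg hs.le hl
    linarith
  · refine (min_le_right _ _).trans ?_
    have := S.localEnergy_nonneg i hlR
    have := mul_le_mul_of_nonneg_left h hs.le
    linarith

/-- A user with a zero downlink channel cannot be served, and its multiplier may grow without bound
in the dual problem; so the dual problem would have no solution. -/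
theorem IsDualOptimal.h_ne_zero {S : MECSystem K N} {lam : Fin K → ℝ} {mu : ℝ}
    (hd : S.IsDualOptimal lam mu) (i : Fin K) : S.h i ≠ 0 := by
  intro hi
  have hH : S.H i = 0 := by
    ext a b; simp [H, hi, Matrix.vecMulVec_apply]
  obtain ⟨m, hm, hmin⟩ := S.exists_pos_le_energy i
  have hub := S.dualFun_le lam mu Matrix.PosSemidef.zero S.admissible_zero
  set c := S.lagrangian 0 0 0 lam mu
  have key : ∀ n : ℕ, (n : ℝ) * m ≤ c := by
    intro n
    have hF : S.F (Pi.single i (n : ℝ)) = 1 := by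
      unfold F
      rw [Finset.sum_eq_zero, sub_zero]
      intro j _
      by_cases hj : j = i
      · subst hj; simp [hH]
      · simp [Pi.single_eq_of_ne hj]
    have hfeas : S.DualFeasible (Pi.single i (n : ℝ)) 0 :=
      ⟨by rw [hF]; exact .one, le_rfl, fun j => by
        by_cases hj : j = i
        · subst hj; simp
        · simp [Pi.single_eq_of_ne hj]⟩
    have hlow : (((n : ℝ) * m : ℝ) : EReal) ≤ S.dualFun (Pi.single i (n : ℝ)) 0 := by
      refine S.le_dualFun _ _ fun Q t ell hQ ha => ?_
      unfold lagrangian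
      rw [hF, one_mul]
      have h1 := mul_nonneg S.T_pos.le hQ.re_trace_nonneg
      have h2 := Finset.single_le_sum (f := fun j => S.α * ell j
        + (Pi.single i (n : ℝ) : Fin K → ℝ) j * S.localEnergy j (ell j)
        + (Pi.single i (n : ℝ) : Fin K → ℝ) j * S.offloadEnergy j (t j) (ell j) + 0 * t j)
        (fun j _ => by
          have h3 : 0 ≤ (Pi.single i (n : ℝ) : Fin K → ℝ) j := hfeas.2.2 j
          have h4 := S.localEnergy_nonneg j (ha j).2.2.1
          have h5 := S.offloadEnergy_nonneg j (ha j).1 (ha j).2.1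
          have h6 := mul_nonneg S.α_pos.le (ha j).2.1
          have h7 := mul_nonneg h3 h4
          have h8 := mul_nonneg h3 h5
          linarith) (Finset.mem_univ i)
      simp only [Pi.single_eq_same] at h2
      have h6 := mul_nonneg S.α_pos.le (ha i).2.1
      have h7 := mul_le_mul_of_nonneg_left
        (hmin (t i) (ell i) (ha i).1 (ha i).2.1 (ha i).2.2.1 (ha i).2.2.2) (Nat.cast_nonneg (α := ℝ) n)
      linarith
    exact EReal.coe_le_coe_iff.1 (hlow.trans ((hd.2 _ _ hfeas).trans hub))
  obtain ⟨n, hn⟩ := exists_nat_gt (c / m)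
  rw [div_lt_iff₀ hm] at hn
  linarith [key n]

end MECSystem

theorem nonneg_of_forall_sub_mul_lt {y z c : ℝ} (h : ∀ n : ℝ, 0 ≤ n → y - n * z < c) : 0 ≤ z := by
  by_contra! hz
  have h1 := h (|c - y| / -z) (div_nonneg (abs_nonneg _) (by linarith))
  have h2 : |c - y| / -z * z = -|c - y| := by
    rw [div_mul_eq_mul_div, div_neg, mul_div_assoc, div_self hz.ne, mul_one]
  rw [h2] at h1
  linarith [le_abs_self (c - y)]

namespace MECSystem

variable {K N : ℕ} (S : MECSystem K N)

/-! ### Convexity and strong duality -/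

theorem convex_admissible : Convex ℝ {p : (Fin K → ℝ) × (Fin K → ℝ) | S.Admissible p.1 p.2} := by
  rw [convex_iff_forall_pos]
  rintro ⟨t, ell⟩ h ⟨t', ell'⟩ h' a b ha hb hab i
  obtain ⟨h1, h2, h3, h4⟩ := h i
  obtain ⟨h1', h2', h3', h4'⟩ := h' i
  simp only [Prod.smul_mk, Prod.mk_add_mk, Pi.add_apply, Pi.smul_apply, smul_eq_mul] at *
  refine ⟨by positivity, by positivity, ?_, fun h0 => ?_⟩
  · calc a * ell i + b * ell' i ≤ a * S.R i + b * S.R i := by gcongr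
      _ = S.R i := by rw [← add_mul, hab, one_mul]
  · have e1 : a * t i = 0 := by nlinarith [mul_nonneg ha.le h1, mul_nonneg hb.le h1']
    have e2 : b * t' i = 0 := by nlinarith [mul_nonneg ha.le h1, mul_nonneg hb.le h1']
    rw [h4 ((mul_eq_zero.1 e1).resolve_left ha.ne'), h4' ((mul_eq_zero.1 e2).resolve_left hb.ne')]
    simp

theorem netEnergy_convex {Q Q' : Matrix (Fin N) (Fin N) ℂ} {t ell t' ell' : Fin K → ℝ}
    (h : S.Admissible t ell) (h' : S.Admissible t' ell') {a b : ℝ} (ha : 0 ≤ a) (hb : 0 ≤ b)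
    (hab : a + b = 1) (i : Fin K) :
    S.netEnergy (a • Q + b • Q') (a • t + b • t') (a • ell + b • ell') i ≤
      a * S.netEnergy Q t ell i + b * S.netEnergy Q' t' ell' i := by
  have hc : S.Admissible (a • t + b • t') (a • ell + b • ell') :=
    S.convex_admissible (x := (t, ell)) h (y := (t', ell')) h' ha hb hab
  have hloc := (S.convexOn_localEnergy i).2 (h i).2.2.1 (h' i).2.2.1 ha hb hab
  have hoff : S.offloadEnergy i ((a • t + b • t') i) ((a • ell + b • ell') i) ≤
      a * S.offloadEnergy i (t i) (ell i) + b * S.offloadEnergy i (t' i) (ell' i) := by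
    refine ((S.offloadEnergy_le_iff i (hc i).1 (hc i).2.1).2 fun r => ?_).2
    have h1 := S.tangent_le_offloadEnergy i (h i).1 (h i).2.2.2 r
    have h2 := S.tangent_le_offloadEnergy i (h' i).1 (h' i).2.2.2 r
    have h3 := mul_le_mul_of_nonneg_left h1 ha
    have h4 := mul_le_mul_of_nonneg_left h2 hb
    simp only [Pi.add_apply, Pi.smul_apply, smul_eq_mul]
    linarith
  simp only [netEnergy, harvested_add, harvested_smul, Pi.add_apply, Pi.smul_apply,
    smul_eq_mul] at *
  linarith

theorem cost_add_smul (Q Q' : Matrix (Fin N) (Fin N) ℂ) (ell ell' : Fin K → ℝ) (a b : ℝ) :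
    S.cost (a • Q + b • Q') (a • ell + b • ell') = a * S.cost Q ell + b * S.cost Q' ell' := by
  simp only [cost, Matrix.trace_add, Matrix.trace_smul, Complex.add_re, Complex.smul_re,
    smul_eq_mul, Pi.add_apply, Pi.smul_apply, mul_add, Finset.sum_add_distrib, Finset.mul_sum]
  have h : ∀ (c : ℝ) (l : Fin K → ℝ), ∑ i, S.α * (c * l i) = ∑ i, c * (S.α * l i) :=
    fun c l => Finset.sum_congr rfl fun i _ => by ring
  rw [h, h]; ring

/-- If the Lagrangian is bounded below, then `F(λ)` is positive semidefinite: otherwise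
the Lagrangian tends to `-∞` along a ray of rank-one covariance matrices. -/
theorem posSemidef_F_of_le_lagrangian {lam : Fin K → ℝ} {mu p : ℝ}
    (h : ∀ Q t ell, Matrix.PosSemidef Q → S.Admissible t ell → p ≤ S.lagrangian Q t ell lam mu) :
    (S.F lam).PosSemidef := by
  refine .of_dotProduct_mulVec_nonneg (S.isHermitian_F lam) fun x => ?_
  refine Complex.nonneg_iff.2 ⟨?_, ((S.isHermitian_F lam).im_star_dotProduct_mulVec_self x).symm⟩
  set z := (star x ⬝ᵥ (S.F lam).mulVec x).re with hz
  have htr : (Matrix.trace (S.F lam * Matrix.vecMulVec x (star x))).re = z := by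
    rw [Matrix.mul_vecMulVec, Matrix.trace_vecMulVec, dotProduct_comm]
  have hTz : 0 ≤ S.T * z := by
    refine nonneg_of_forall_sub_mul_lt (y := -S.lagrangian 0 0 0 lam mu) (c := 1 - p)
      fun n hn => ?_
    have h1 := h (n • Matrix.vecMulVec x (star x)) 0 0
      ((Matrix.posSemidef_vecMulVec_self_star x).smul hn) S.admissible_zero
    have h2 : S.lagrangian (n • Matrix.vecMulVec x (star x)) 0 0 lam mu =
        S.lagrangian 0 0 0 lam mu + n * (S.T * z) := by
      simp only [lagrangian, Matrix.mul_smul, Matrix.trace_smul, Complex.smul_re, htr, mul_zero,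
        Matrix.trace_zero, Complex.zero_re, smul_eq_mul]
      ring
    linarith
  exact nonneg_of_mul_nonneg_right hTz S.T_pos

/-- The convex set of attainable constraint and cost values is separated from the values that
would beat the bound `p`; the Slater point makes the separating hyperplane non-vertical. -/
theorem exists_dual_ge (hh : ∀ i, S.h i ≠ 0) {p : ℝ}
    (hp : ∀ Q t ell, S.ConstFreqFeasible Q t ell → p ≤ S.cost Q ell) :
    ∃ lam mu, S.DualFeasible lam mu ∧ (p : EReal) ≤ S.dualFun lam mu := by
  let U : Set ((Fin K → ℝ) × ℝ × ℝ) := {x | (∀ i, x.1 i < 0) ∧ x.2.1 < 0 ∧ x.2.2 < p}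
  let A : Set ((Fin K → ℝ) × ℝ × ℝ) := {x | ∃ Q t ell, Matrix.PosSemidef Q ∧ S.Admissible t ell ∧
    (∀ i, S.netEnergy Q t ell i ≤ x.1 i) ∧ ∑ i, t i - S.T ≤ x.2.1 ∧ S.cost Q ell ≤ x.2.2}
  have hUconv : Convex ℝ U := by
    rw [convex_iff_forall_pos]
    rintro x ⟨h1, h2, h3⟩ y ⟨h1', h2', h3'⟩ a b ha hb hab
    simp only [U, Set.mem_ofPred_eq, Prod.fst_add, Prod.snd_add, Prod.smul_fst, Prod.smul_snd,
      Pi.add_apply, Pi.smul_apply, smul_eq_mul]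
    refine ⟨fun i => ?_, ?_, ?_⟩
    · have := mul_pos ha (neg_pos.2 (h1 i)); have := mul_pos hb (neg_pos.2 (h1' i)); linarith
    · have := mul_pos ha (neg_pos.2 h2); have := mul_pos hb (neg_pos.2 h2'); linarith
    · have e : p = a * p + b * p := by rw [← add_mul, hab, one_mul]
      rw [e]; gcongr
  have hUopen : IsOpen U := by
    have : U = (⋂ i, {x | x.1 i < 0}) ∩ ({x | x.2.1 < 0} ∩ {x | x.2.2 < p}) := by
      ext x; simp [U]
    rw [this]
    exact (isOpen_iInter_of_finite fun i => isOpen_lt (by fun_prop) continuous_const).inter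
      ((isOpen_lt (by fun_prop) continuous_const).inter (isOpen_lt (by fun_prop) continuous_const))
  have hAconv : Convex ℝ A := by
    rintro x ⟨Q, t, ell, hQ, hadm, h1, h2, h3⟩ y ⟨Q', t', ell', hQ', hadm', h1', h2', h3'⟩ a b ha hb
      hab
    refine ⟨a • Q + b • Q', a • t + b • t', a • ell + b • ell', (hQ.smul ha).add (hQ'.smul hb),
      S.convex_admissible (x := (t, ell)) hadm (y := (t', ell')) hadm' ha hb hab,
      fun i => (S.netEnergy_convex hadm hadm' ha hb hab i).trans ?_, ?_, ?_⟩
    · simp only [Prod.fst_add, Prod.smul_fst, Pi.add_apply, Pi.smul_apply, smul_eq_mul]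
      have := h1 i
      have := h1' i
      gcongr
    · simp only [Prod.snd_add, Prod.smul_snd, Prod.fst_add, Prod.smul_fst, Pi.add_apply,
        Pi.smul_apply, smul_eq_mul, Finset.sum_add_distrib, ← Finset.mul_sum]
      have e : S.T = a * S.T + b * S.T := by rw [← add_mul, hab, one_mul]
      have := mul_le_mul_of_nonneg_left h2 ha
      have := mul_le_mul_of_nonneg_left h2' hb
      linarith
    · rw [cost_add_smul]
      simp only [Prod.snd_add, Prod.smul_snd, smul_eq_mul]
      gcongr
  have hdisj : Disjoint U A := by
    rw [Set.disjoint_left]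
    rintro x ⟨h1, h2, h3⟩ ⟨Q, t, ell, hQ, hadm, h1', h2', h3'⟩
    have := hp Q t ell ⟨hQ, fun i => (h1' i).trans (h1 i).le, by linarith, hadm⟩
    linarith
  obtain ⟨f, c, hfU, hfA⟩ := geometric_hahn_banach_open hUconv hUopen hAconv hdisj
  set lam : Fin K → ℝ := fun i => f (Pi.single i 1, 0, 0) with hlam
  set mu : ℝ := f (0, 1, 0) with hmu
  set nu : ℝ := f (0, 0, 1) with hnu
  have hf : ∀ u v s, f (u, v, s) = ∑ i, u i * lam i + v * mu + s * nu := by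
    intro u v s
    have e : ((u, v, s) : (Fin K → ℝ) × ℝ × ℝ) =
        ∑ i, u i • ((Pi.single i 1, 0, 0) : (Fin K → ℝ) × ℝ × ℝ) + v • (0, 1, 0)
          + s • (0, 0, 1) := by
      refine Prod.ext ?_ (Prod.ext ?_ ?_)
      · ext j
        simp [Prod.fst_sum, Finset.sum_apply, Pi.single_apply]
      · simp [Prod.snd_sum]
      · simp [Prod.snd_sum]
    rw [e]
    simp only [map_add, map_sum, map_smul, smul_eq_mul, hlam, hmu, hnu]
  have hlam0 : ∀ j, 0 ≤ lam j := fun j => by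
    refine nonneg_of_forall_sub_mul_lt (y := f (-1, -1, p - 1)) (c := c) fun n hn => ?_
    have h1 : f (-1 - n • Pi.single j 1, -1, p - 1) < c := by
      refine hfU _ ⟨fun i => ?_, by norm_num, by simp⟩
      by_cases hij : i = j
      · subst hij; simp; linarith
      · simp [Pi.single_eq_of_ne hij]
    have e : ((-1 - n • Pi.single j 1, -1, p - 1) : (Fin K → ℝ) × ℝ × ℝ) =
        (-1, -1, p - 1) - n • (Pi.single j 1, 0, 0) := by simp
    rw [e, map_sub, map_smul, smul_eq_mul] at h1
    exact h1
  have hmu0 : 0 ≤ mu := by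
    refine nonneg_of_forall_sub_mul_lt (y := f (-1, -1, p - 1)) (c := c) fun n hn => ?_
    have h1 : f (-1, -1 - n, p - 1) < c :=
      hfU _ ⟨fun i => by simp, by simp only; linarith, by simp⟩
    rw [hf] at h1 ⊢
    linarith
  have hnu0 : 0 ≤ nu := by
    refine nonneg_of_forall_sub_mul_lt (y := f (-1, -1, p - 1)) (c := c) fun n hn => ?_
    have h1 : f (-1, -1, p - 1 - n) < c :=
      hfU _ ⟨fun i => by simp, by norm_num, by simp only; linarith⟩
    rw [hf] at h1 ⊢
    linarith
  have hpc : p * nu ≤ c := by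
    by_contra! hlt
    set w := ∑ i, lam i + mu + nu with hw
    have hw0 : 0 ≤ w := add_nonneg (add_nonneg (Finset.sum_nonneg fun i _ => hlam0 i) hmu0) hnu0
    set ε := (p * nu - c) / (w + 1) with hε
    have hε0 : 0 < ε := div_pos (by linarith) (by linarith)
    have hεw : ε * (w + 1) = p * nu - c := by rw [hε]; field_simp
    have h1 : f (fun _ => -ε, -ε, p - ε) < c :=
      hfU _ ⟨fun i => by simpa using hε0, by simpa using hε0, by simpa using hε0⟩
    rw [hf, ← Finset.mul_sum] at h1
    have : -ε * ∑ i, lam i + -ε * mu + (p - ε) * nu = p * nu - ε * w := by rw [hw]; ring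
    nlinarith
  have hnu_pos : 0 < nu := by
    refine lt_of_le_of_ne hnu0 fun h0 => ?_
    obtain ⟨Q, hQ, hs⟩ := S.exists_strictly_feasible hh
    have h1 := hfA (S.netEnergy Q 0 0, -S.T, S.cost Q 0)
      ⟨Q, 0, 0, hQ, S.admissible_zero, fun i => le_rfl, by simp, le_rfl⟩
    have h2 : f (-1, -1, p - 1) < c := hfU _ ⟨fun i => by simp, by norm_num, by simp⟩
    rw [hf, ← h0] at h1 h2
    rw [← h0] at hpc
    have h3 : ∀ i ∈ Finset.univ, S.netEnergy Q 0 0 i * lam i ≤ 0 := fun i _ =>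
      mul_nonpos_of_nonpos_of_nonneg (hs i).le (hlam0 i)
    have h4 := Finset.sum_nonpos h3
    have h5 := mul_nonneg S.T_pos.le hmu0
    have hmuz : mu = 0 := by
      have : S.T * mu = 0 := by linarith
      exact (mul_eq_zero.1 this).resolve_left S.T_pos.ne'
    have hlamz : ∀ i, lam i = 0 := fun i =>
      (mul_eq_zero.1 ((Finset.sum_eq_zero_iff_of_nonpos h3).1 (by linarith) i
        (Finset.mem_univ i))).resolve_left (hs i).ne
    simp only [hmuz, hlamz, mul_zero, Finset.sum_const_zero, add_zero] at h2
    linarith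
  have hL : ∀ Q t ell, Matrix.PosSemidef Q → S.Admissible t ell →
      p ≤ S.lagrangian Q t ell (fun i => lam i / nu) (mu / nu) := by
    intro Q t ell hQ hadm
    have h1 := hfA (S.netEnergy Q t ell, ∑ i, t i - S.T, S.cost Q ell)
      ⟨Q, t, ell, hQ, hadm, fun i => le_rfl, le_rfl, le_rfl⟩
    rw [hf] at h1
    have h2 : ∑ i, lam i / nu * S.netEnergy Q t ell i =
        (∑ i, S.netEnergy Q t ell i * lam i) / nu := by
      rw [Finset.sum_div]
      exact Finset.sum_congr rfl fun i _ => by ring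
    rw [lagrangian_eq, h2]
    have h3 : p ≤ (∑ i, S.netEnergy Q t ell i * lam i + (∑ i, t i - S.T) * mu
        + S.cost Q ell * nu) / nu := by
      rw [le_div_iff₀ hnu_pos]; linarith
    refine h3.trans (le_of_eq ?_)
    field_simp
    ring
  exact ⟨fun i => lam i / nu, mu / nu, ⟨S.posSemidef_F_of_le_lagrangian hL,
    div_nonneg hmu0 hnu0, fun i => div_nonneg (hlam0 i) hnu0⟩, S.le_dualFun _ _ hL⟩

/-! ### Minimizers of the Lagrangian -/

theorem rOpt_spec {lam : Fin K → ℝ} {mu : ℝ} {i : Fin K} (hl : 0 < lam i) (hmu : 0 ≤ mu) :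
    0 < S.rOpt lam mu i ∧ S.timeSlope i (S.rOpt lam mu i) = -(mu / lam i) := by
  have hg := S.gt_pos i
  have hσ := S.σ_pos
  have hB := S.B_pos
  have hp := S.pc_pos i
  have hlog := Real.log_pos (one_lt_two)
  set x := S.gt i / (S.σ ^ 2 * Real.exp 1) * (mu / lam i + S.pc i) - 1 / Real.exp 1 with hx
  have hpos : 0 < S.gt i / (S.σ ^ 2 * Real.exp 1) * (mu / lam i + S.pc i) := by positivity
  obtain ⟨hw1, hw2⟩ := lambertW0_spec (x := x) (by rw [hx]; linarith)
  set w := lambertW0 x with hw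
  have hr : S.rOpt lam mu i = S.B / Real.log 2 * (w + 1) := rfl
  have hw1' : -1 < w := by
    refine lt_of_le_of_ne hw1 fun h => ?_
    rw [← h, Real.exp_neg] at hw2
    have : x = -(1 / Real.exp 1) := by rw [← hw2]; ring
    linarith
  refine ⟨by rw [hr]; exact mul_pos (by positivity) (by linarith), ?_⟩
  have hrB : S.rOpt lam mu i / S.B = (w + 1) / Real.log 2 := by rw [hr]; field_simp
  have hpow : (2 : ℝ) ^ ((w + 1) / Real.log 2) = Real.exp w * Real.exp 1 := by
    rw [Real.rpow_def_of_pos two_pos, ← Real.exp_add]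
    congr 1; field_simp
  have hweq : w * (Real.exp w * Real.exp 1) = S.gt i / S.σ ^ 2 * (mu / lam i + S.pc i) - 1 := by
    rw [← mul_assoc, hw2, hx]; field_simp
  unfold timeSlope offSlope β
  rw [hrB, hpow, hr]
  have e : S.σ ^ 2 * (Real.exp w * Real.exp 1 - 1) / S.gt i + S.pc i -
      S.σ ^ 2 * Real.log 2 / (S.B * S.gt i) * (Real.exp w * Real.exp 1) *
        (S.B / Real.log 2 * (w + 1)) =
      S.pc i - S.σ ^ 2 / S.gt i * (w * (Real.exp w * Real.exp 1) + 1) := by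
    field_simp
    ring
  rw [e, hweq]
  field_simp
  ring

theorem ellOpt_nonneg (lam : Fin K → ℝ) (mu : ℝ) (i : Fin K) : 0 ≤ S.ellOpt lam mu i := by
  unfold ellOpt; split_ifs
  · exact le_max_left _ _
  · exact le_rfl

theorem ellOpt_lt (lam : Fin K → ℝ) (mu : ℝ) (i : Fin K) : S.ellOpt lam mu i < S.R i := by
  have hR := S.R_pos i
  unfold ellOpt; split_ifs with h
  · refine max_lt hR (sub_lt_self _ (Real.sqrt_pos.2 ?_))
    have := S.offSlope_pos i (S.rOpt lam mu i)
    have := S.κ_pos i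
    have := S.C_pos i
    have := S.T_pos
    have := S.α_pos
    unfold offSlope at *
    positivity
  · exact hR

theorem admissible_opt {lam : Fin K → ℝ} {mu : ℝ} (hmu : 0 ≤ mu) :
    S.Admissible (S.tOpt lam mu) (S.ellOpt lam mu) := by
  intro i
  refine ⟨?_, S.ellOpt_nonneg lam mu i, (S.ellOpt_lt lam mu i).le, fun h => ?_⟩
  · unfold tOpt; split_ifs with h
    · exact div_nonneg (S.ellOpt_nonneg lam mu i) (S.rOpt_spec h hmu).1.le
    · exact le_rfl
  · by_cases hl : 0 < lam i
    · rw [tOpt, if_pos hl] at h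
      exact (div_eq_zero_iff.1 h).resolve_right (S.rOpt_spec hl hmu).1.ne'
    · simp [ellOpt, hl]

/-- After elimination of the offloading time, the share of user `i` in the Lagrangian is `λ_i` times
the strictly convex cubic `(α / λ_i + s) ℓ + localEnergy ℓ`, where `s` is the slope of the offloading
energy at the rate `rOpt`. Its only minimizer on `[0, R_i]` is the clipped stationary point
`ellOpt`. -/
theorem eq_ellOpt_of_le {lam : Fin K → ℝ} {mu : ℝ} {i : Fin K} (hl : 0 < lam i) {ell : ℝ}
    (h0 : 0 ≤ ell) (hR : ell ≤ S.R i)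
    (hle : (S.α / lam i + S.offSlope i (S.rOpt lam mu i)) * ell + S.localEnergy i ell ≤
      (S.α / lam i + S.offSlope i (S.rOpt lam mu i)) * S.ellOpt lam mu i
        + S.localEnergy i (S.ellOpt lam mu i)) :
    ell = S.ellOpt lam mu i := by
  have ha := S.localCoeff_pos i
  have hs := S.offSlope_pos i (S.rOpt lam mu i)
  have hα := S.α_pos
  have hκ := S.κ_pos i
  have hC := S.C_pos i
  have hT := S.T_pos
  set D := S.α / lam i + S.offSlope i (S.rOpt lam mu i) with hD
  have hD0 : 0 < D := by positivity
  set a := S.κ i * S.C i ^ 3 / S.T ^ 2 with haD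
  set w := Real.sqrt (S.T ^ 2 / (3 * S.κ i * S.C i ^ 3) * D) with hw
  have hw0 : 0 < w := Real.sqrt_pos.2 (by positivity)
  have hDw : D = 3 * a * w ^ 2 := by
    rw [hw, Real.sq_sqrt (by positivity), haD]; field_simp
  have hopt : S.ellOpt lam mu i = max 0 (S.R i - w) := by
    rw [ellOpt, if_pos hl]; rfl
  rw [hopt] at hle ⊢
  simp only [localEnergy_eq, ← haD] at hle
  rcases le_total w (S.R i) with hc | hc
  · rw [max_eq_right (by linarith)] at hle ⊢
    -- with `y = R_i - ℓ` the gap is `a (y³ - 3 w² y + 2 w³)`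
    have h1 : a * ((S.R i - ell - w) ^ 2 * (S.R i - ell + 2 * w)) ≤ 0 := by
      rw [hDw] at hle; linear_combination hle
    have h2 : (S.R i - ell - w) ^ 2 ≤ 0 :=
      nonpos_of_mul_nonpos_left (nonpos_of_mul_nonpos_right h1 ha) (by linarith)
    have h3 := pow_eq_zero_iff (two_ne_zero) |>.1 (le_antisymm h2 (sq_nonneg _))
    linarith
  · rw [max_eq_left (by linarith)] at hle ⊢
    -- here the cubic increases on `[0, R_i]`
    have h1 : a * (ell * (3 * w ^ 2 - (3 * S.R i ^ 2 - 3 * S.R i * ell + ell ^ 2))) ≤ 0 := by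
      rw [hDw] at hle; linear_combination hle
    have h2 := nonpos_of_mul_nonpos_right h1 ha
    by_contra hne
    have hpos : 0 < ell := lt_of_le_of_ne h0 (Ne.symm hne)
    have h3 := nonpos_of_mul_nonpos_right h2 hpos
    nlinarith [mul_pos hpos hpos, mul_nonneg h0 (sub_nonneg.2 hR)]

/-- The share of user `i` in the Lagrangian. -/
noncomputable def userLagrangian (lam : Fin K → ℝ) (mu : ℝ) (i : Fin K) (t ell : ℝ) : ℝ :=
  S.α * ell + lam i * S.localEnergy i ell + lam i * S.offloadEnergy i t ell + mu * t

theorem offloadEnergy_opt {lam : Fin K → ℝ} {mu : ℝ} (hmu : 0 ≤ mu) (i : Fin K) :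
    S.offloadEnergy i (S.tOpt lam mu i) (S.ellOpt lam mu i) =
      S.tOpt lam mu i / S.gt i * S.β (S.rOpt lam mu i) + S.pc i * S.tOpt lam mu i := by
  by_cases h0 : S.tOpt lam mu i = 0
  · simp [h0, offloadEnergy]
  · have hl : 0 < lam i := by
      by_contra hl; exact h0 (by simp [tOpt, hl])
    have hr := (S.rOpt_spec hl hmu).1
    have e : S.ellOpt lam mu i / S.tOpt lam mu i = S.rOpt lam mu i := by
      rw [div_eq_iff h0, tOpt, if_pos hl]; field_simp
    rw [offloadEnergy, e]

theorem userLagrangian_of_pos {lam : Fin K → ℝ} {mu : ℝ} (hmu : 0 ≤ mu) {i : Fin K}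
    (hl : 0 < lam i) :
    S.userLagrangian lam mu i (S.tOpt lam mu i) (S.ellOpt lam mu i) =
      lam i * ((S.α / lam i + S.offSlope i (S.rOpt lam mu i)) * S.ellOpt lam mu i
        + S.localEnergy i (S.ellOpt lam mu i)) := by
  obtain ⟨hr, hts⟩ := S.rOpt_spec hl hmu
  have e : S.offloadEnergy i (S.tOpt lam mu i) (S.ellOpt lam mu i) =
      S.offSlope i (S.rOpt lam mu i) * S.ellOpt lam mu i
        + S.timeSlope i (S.rOpt lam mu i) * S.tOpt lam mu i := by
    have hell : S.ellOpt lam mu i = S.rOpt lam mu i * S.tOpt lam mu i := by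
      rw [tOpt, if_pos hl]; field_simp
    rw [S.offloadEnergy_opt hmu, timeSlope, hell]
    ring
  rw [userLagrangian, e, hts]
  field_simp
  ring

/-- For `λ_i > 0`, the minimizer of the share of user `i` is unique. The tangent plane at the rate
`rOpt` has slope `-μ / λ_i` in the time, so that it bounds the share by a function of `ℓ` only. -/
theorem eq_opt_of_userLagrangian_le {lam : Fin K → ℝ} {mu : ℝ} (hmu : 0 ≤ mu) {i : Fin K}
    (hl : 0 < lam i) {t ell : ℝ} (ht : 0 ≤ t) (h0 : 0 ≤ ell) (hR : ell ≤ S.R i)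
    (hz : t = 0 → ell = 0)
    (hle : S.userLagrangian lam mu i t ell ≤
      S.userLagrangian lam mu i (S.tOpt lam mu i) (S.ellOpt lam mu i)) :
    ell = S.ellOpt lam mu i ∧ t = S.tOpt lam mu i := by
  rw [S.userLagrangian_of_pos hmu hl] at hle
  obtain ⟨hr, hts⟩ := S.rOpt_spec hl hmu
  have hexp : S.userLagrangian lam mu i t ell =
      lam i * ((S.α / lam i + S.offSlope i (S.rOpt lam mu i)) * ell + S.localEnergy i ell)
        + lam i * (S.offloadEnergy i t ell
          - (S.offSlope i (S.rOpt lam mu i) * ell + S.timeSlope i (S.rOpt lam mu i) * t)) := by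
    rw [userLagrangian, hts]; field_simp; ring
  rw [hexp] at hle
  have htan := S.tangent_le_offloadEnergy i ht hz (S.rOpt lam mu i)
  have hell : ell = S.ellOpt lam mu i := by
    refine S.eq_ellOpt_of_le hl h0 hR (le_of_mul_le_mul_left ?_ hl)
    have := mul_nonneg hl.le (sub_nonneg.2 htan)
    linarith
  refine ⟨hell, ?_⟩
  rw [← hell] at hle
  have h1 : S.offloadEnergy i t ell
      - (S.offSlope i (S.rOpt lam mu i) * ell + S.timeSlope i (S.rOpt lam mu i) * t) ≤ 0 :=
    nonpos_of_mul_nonpos_right (by linarith) hl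
  have h2 := S.eq_mul_of_offloadEnergy_le i ht hz (r := S.rOpt lam mu i) (by linarith)
  rw [tOpt, if_pos hl, ← hell, h2]
  field_simp

theorem userLagrangian_opt_le {lam : Fin K → ℝ} {mu : ℝ} (hmu : 0 ≤ mu) (hlam : ∀ i, 0 ≤ lam i)
    {t ell : Fin K → ℝ} (hadm : S.Admissible t ell) (i : Fin K) :
    S.userLagrangian lam mu i (S.tOpt lam mu i) (S.ellOpt lam mu i) ≤
      S.userLagrangian lam mu i (t i) (ell i) := by
  obtain ⟨h1, h2, h3, h4⟩ := hadm i
  rcases (hlam i).eq_or_lt with hl | hl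
  · have := mul_nonneg S.α_pos.le h2
    have := mul_nonneg hmu h1
    simp [userLagrangian, tOpt, ellOpt, ← hl]
    linarith
  · rcases le_total (S.userLagrangian lam mu i (S.tOpt lam mu i) (S.ellOpt lam mu i))
      (S.userLagrangian lam mu i (t i) (ell i)) with h | h
    · exact h
    · obtain ⟨e1, e2⟩ := S.eq_opt_of_userLagrangian_le hmu hl h1 h2 h3 h4 h
      rw [e1, e2]

theorem eq_opt_of_lagrangian_le {lam : Fin K → ℝ} {mu : ℝ} (hmu : 0 ≤ mu) (hlam : ∀ i, 0 ≤ lam i)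
    {Q : Matrix (Fin N) (Fin N) ℂ} {t ell : Fin K → ℝ} (hQ : Q.PosSemidef)
    (hadm : S.Admissible t ell)
    (hle : ((S.lagrangian Q t ell lam mu : ℝ) : EReal) ≤ S.dualFun lam mu) :
    (∀ i, ell i = S.ellOpt lam mu i) ∧ ∀ i, 0 < lam i ∨ 0 < mu → t i = S.tOpt lam mu i := by
  have h1 := EReal.coe_le_coe_iff.1 (hle.trans (S.dualFun_le lam mu hQ (S.admissible_opt (lam := lam) hmu)))
  have h2 : ∀ i ∈ Finset.univ, S.userLagrangian lam mu i (S.tOpt lam mu i) (S.ellOpt lam mu i) ≤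
      S.userLagrangian lam mu i (t i) (ell i) :=
    fun i _ => S.userLagrangian_opt_le hmu hlam hadm i
  have h3 : ∑ i, S.userLagrangian lam mu i (t i) (ell i) ≤
      ∑ i, S.userLagrangian lam mu i (S.tOpt lam mu i) (S.ellOpt lam mu i) := by
    unfold lagrangian at h1
    unfold userLagrangian
    linarith
  have h4 := (Finset.sum_eq_sum_iff_of_le h2).1 (le_antisymm (Finset.sum_le_sum h2) h3)
  have key : ∀ i, ell i = S.ellOpt lam mu i ∧ (0 < lam i ∨ 0 < mu → t i = S.tOpt lam mu i) := by
    intro i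
    obtain ⟨g1, g2, g3, g4⟩ := hadm i
    have h5 := h4 i (Finset.mem_univ i)
    rcases (hlam i).eq_or_lt with hl | hl
    · simp [userLagrangian, tOpt, ellOpt, ← hl] at h5 ⊢
      have e1 := mul_nonneg S.α_pos.le g2
      have e2 := mul_nonneg hmu g1
      refine ⟨(mul_eq_zero.1 (by linarith : S.α * ell i = 0)).resolve_left S.α_pos.ne',
        fun hm => (mul_eq_zero.1 (by linarith : mu * t i = 0)).resolve_left hm.ne'⟩
    · obtain ⟨e1, e2⟩ := S.eq_opt_of_userLagrangian_le hmu hl g1 g2 g3 g4 h5.ge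
      exact ⟨e1, fun _ => e2⟩
  exact ⟨fun i => (key i).1, fun i => (key i).2⟩

/-! ### Optimal solutions of the problem with arbitrary frequencies -/

theorem cycles_nonneg (i : Fin K) {ell : ℝ} (h : ell ≤ S.R i) : 0 ≤ S.cycles i ell :=
  mul_nonneg (S.C_pos i).le (sub_nonneg.2 h)

theorem mul_cycles_pow_eq (i : Fin K) (ell : ℝ) :
    S.κ i * (S.cycles i ell ^ 3 / S.T ^ 2) = S.localEnergy i ell := by
  unfold cycles localEnergy; ring

variable {S}

theorem Feasible.localEnergy_le {x : MECDesign K N} (hx : S.Feasible x) (i : Fin K) :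
    S.localEnergy i (x.ell i) ≤
      cycleSum (S.cycles i (x.ell i)) (fun n => S.κ i * x.f i n ^ 2) := by
  have h := (cycleSum_sq_ge (S.cycles_nonneg i (hx.admissible i).2.2.1) S.T_pos
    (fun n hn => (hx.freq i n hn).1) (hx.latency i)).1
  rw [cycleSum_const_mul, ← mul_cycles_pow_eq]
  exact mul_le_mul_of_nonneg_left h (S.κ_pos i).le

theorem Feasible.constFreqFeasible {x : MECDesign K N} (hx : S.Feasible x) :
    S.ConstFreqFeasible x.Q x.t x.ell :=
  ⟨hx.posSemidef, fun i => by
    have h1 := hx.localEnergy_le i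
    have h2 := hx.energy i
    unfold netEnergy
    linarith, hx.time, hx.admissible⟩

theorem sdpFeasible_iff {lam : Fin K → ℝ} {mu : ℝ} (hmu : 0 ≤ mu)
    {Q : Matrix (Fin N) (Fin N) ℂ} :
    S.SDPFeasible lam mu Q ↔
      Q.PosSemidef ∧ ∀ i, S.netEnergy Q (S.tOpt lam mu) (S.ellOpt lam mu) i ≤ 0 := by
  simp only [SDPFeasible, netEnergy, S.offloadEnergy_opt hmu, localEnergy, ← add_assoc]

/-- With the constant frequencies `fOpt` a point of the constant-frequency problem with the offloaded
bits `ellOpt` is feasible for (P1). -/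
theorem ConstFreqFeasible.feasible {lam : Fin K → ℝ} {mu : ℝ} {x : MECDesign K N}
    (hx : S.ConstFreqFeasible x.Q x.t x.ell) (hell : ∀ i, x.ell i = S.ellOpt lam mu i)
    (hf : ∀ i (n : ℕ), (n : ℝ) < S.cycles i (S.ellOpt lam mu i) → x.f i n = S.fOpt lam mu i)
    (hfmax : ∀ i, S.fOpt lam mu i ≤ S.fmax i) : S.Feasible x := by
  have hT := S.T_pos
  have hcyc : ∀ i, 0 < S.cycles i (S.ellOpt lam mu i) := fun i =>
    mul_pos (S.C_pos i) (sub_pos.2 (S.ellOpt_lt lam mu i))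
  have hfO : ∀ i, S.fOpt lam mu i = S.cycles i (S.ellOpt lam mu i) / S.T := fun i => rfl
  refine ⟨hx.posSemidef, fun i => ?_, fun i => ?_, hx.time, hx.admissible, fun i n hn => ?_⟩
  · have := hcyc i
    rw [hell, cycleSum_congr (b := fun _ => 1 / S.fOpt lam mu i) this.le
      (fun n hn => by rw [hf i n hn]), cycleSum_const, hfO]
    refine le_of_eq ?_
    field_simp
  · have h1 := hx.energy i
    have h2 : cycleSum (S.cycles i (x.ell i)) (fun n => S.κ i * x.f i n ^ 2) =
        S.localEnergy i (x.ell i) := by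
      rw [hell, cycleSum_congr (b := fun _ => S.κ i * S.fOpt lam mu i ^ 2) (hcyc i).le
        (fun n hn => by rw [hf i n hn]), cycleSum_const, hfO, ← mul_cycles_pow_eq]
      ring
    rw [h2]
    exact h1
  · rw [hell] at hn
    rw [hf i n hn]
    exact ⟨by rw [hfO]; exact div_pos (hcyc i) hT, hfmax i⟩

theorem ConstFreqFeasible.lagrangian_le {Q : Matrix (Fin N) (Fin N) ℂ} {t ell lam : Fin K → ℝ}
    {mu : ℝ} (hx : S.ConstFreqFeasible Q t ell) (hlam : ∀ i, 0 ≤ lam i) (hmu : 0 ≤ mu) :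
    S.lagrangian Q t ell lam mu ≤ S.cost Q ell := by
  rw [lagrangian_eq]
  have h1 : ∑ i, lam i * S.netEnergy Q t ell i ≤ 0 :=
    Finset.sum_nonpos fun i _ => mul_nonpos_of_nonneg_of_nonpos (hlam i) (hx.energy i)
  have h2 := mul_nonpos_of_nonneg_of_nonpos hmu (sub_nonpos.2 hx.time)
  linarith

/-- By strong duality, the optimal value of the constant-frequency problem is attained and does not
exceed the optimal value of the dual problem. -/
theorem IsDualOptimal.exists_minimizer {lam : Fin K → ℝ} {mu : ℝ} (hd : S.IsDualOptimal lam mu) :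
    ∃ Q t ell, S.ConstFreqFeasible Q t ell ∧
      (∀ Q' t' ell', S.ConstFreqFeasible Q' t' ell' → S.cost Q ell ≤ S.cost Q' ell') ∧
      ((S.cost Q ell : ℝ) : EReal) ≤ S.dualFun lam mu := by
  obtain ⟨Q, t, ell, hf, hmin⟩ := S.exists_constFreq_minimizer hd.h_ne_zero
  obtain ⟨lam', mu', hfeas, hle⟩ := S.exists_dual_ge hd.h_ne_zero hmin
  exact ⟨Q, t, ell, hf, hmin, hle.trans (hd.2 _ _ hfeas)⟩

/-- Solutions of the constant-frequency problem minimize the Lagrangian at the dual optimum. -/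
theorem IsDualOptimal.eq_opt {lam : Fin K → ℝ} {mu : ℝ} (hd : S.IsDualOptimal lam mu)
    {Q : Matrix (Fin N) (Fin N) ℂ} {t ell : Fin K → ℝ} (hx : S.ConstFreqFeasible Q t ell)
    (hle : ((S.cost Q ell : ℝ) : EReal) ≤ S.dualFun lam mu) :
    (∀ i, ell i = S.ellOpt lam mu i) ∧ ∀ i, 0 < lam i ∨ 0 < mu → t i = S.tOpt lam mu i :=
  S.eq_opt_of_lagrangian_le hd.1.2.1 hd.1.2.2 hx.posSemidef hx.admissible
    ((EReal.coe_le_coe_iff.2 (hx.lagrangian_le hd.1.2.2 hd.1.2.1)).trans hle)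

/-- A user with multiplier zero offloads nothing, so its possibly positive offloading time can be
set to zero without harm. -/
theorem IsDualOptimal.constFreqFeasible_opt {lam : Fin K → ℝ} {mu : ℝ}
    (hd : S.IsDualOptimal lam mu) {Q : Matrix (Fin N) (Fin N) ℂ} {t ell : Fin K → ℝ}
    (hx : S.ConstFreqFeasible Q t ell)
    (hle : ((S.cost Q ell : ℝ) : EReal) ≤ S.dualFun lam mu) :
    S.ConstFreqFeasible Q (S.tOpt lam mu) (S.ellOpt lam mu) := by
  obtain ⟨hell, ht⟩ := hd.eq_opt hx hle
  have key : ∀ i, S.tOpt lam mu i ≤ t i ∧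
      S.netEnergy Q (S.tOpt lam mu) (S.ellOpt lam mu) i ≤ S.netEnergy Q t ell i := by
    intro i
    rcases (hd.1.2.2 i).eq_or_lt with hl | hl
    · have h0 : S.tOpt lam mu i = 0 := by simp [tOpt, ← hl]
      have h1 := S.offloadEnergy_nonneg i (hx.admissible i).1 (hx.admissible i).2.1
      refine ⟨h0 ▸ (hx.admissible i).1, ?_⟩
      unfold netEnergy
      rw [h0, offloadEnergy_zero, ← hell]
      linarith
    · unfold netEnergy
      rw [ht i (Or.inl hl), hell i]
      exact ⟨le_rfl, le_rfl⟩
  exact ⟨hx.posSemidef, fun i => (key i).2.trans (hx.energy i),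
    (Finset.sum_le_sum fun i _ => (key i).1).trans hx.time, S.admissible_opt hd.1.2.1⟩

/-- The covariance matrix of a solution of the constant-frequency problem solves the semidefinite
program: the two costs differ by a constant, as `ℓ` is determined by the dual variables. -/
theorem IsDualOptimal.isSDPSolution {lam : Fin K → ℝ} {mu : ℝ} (hd : S.IsDualOptimal lam mu)
    {Q : Matrix (Fin N) (Fin N) ℂ} {t ell : Fin K → ℝ} (hx : S.ConstFreqFeasible Q t ell)
    (hmin : ∀ Q' t' ell', S.ConstFreqFeasible Q' t' ell' → S.cost Q ell ≤ S.cost Q' ell')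
    (hle : ((S.cost Q ell : ℝ) : EReal) ≤ S.dualFun lam mu) : S.IsSDPSolution lam mu Q := by
  have hmu := hd.1.2.1
  have hopt := hd.constFreqFeasible_opt hx hle
  have hell : ell = S.ellOpt lam mu := funext (hd.eq_opt hx hle).1
  refine ⟨(sdpFeasible_iff hmu).2 ⟨hopt.posSemidef, hopt.energy⟩, fun Q' hQ' => ?_⟩
  obtain ⟨h1, h2⟩ := (sdpFeasible_iff hmu).1 hQ'
  have h3 := hmin Q' _ _ ⟨h1, h2, hopt.time, hopt.admissible⟩
  rw [hell] at h3
  unfold cost at h3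
  linarith

end MECSystem

/-- The dual variables `(lam, mu)` are an arbitrary optimal solution of the dual problem, and the
CPU frequencies given by the formula respect the maximum frequencies. Then the offloading rates are
positive, the semidefinite program has a solution, every design given by the formulas is an optimal
solution of (P1), and every optimal solution of (P1) is given by them, except that the
times and frequencies need not be unique for users whose dual variable is zero. -/
theorem proposition1 {K N : ℕ} (S : MECSystem K N) (lam : Fin K → ℝ) (mu : ℝ)
    (hdual : S.IsDualOptimal lam mu)
    (hfmax : ∀ i, S.fOpt lam mu i ≤ S.fmax i) :
    (∀ i, 0 < lam i → 0 < S.rOpt lam mu i) ∧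
    (∃ Q : Matrix (Fin N) (Fin N) ℂ, S.IsSDPSolution lam mu Q) ∧
    (∀ x : MECDesign K N,
      (∀ i, x.ell i = S.ellOpt lam mu i) →
      (∀ i, x.t i = S.tOpt lam mu i) →
      (∀ i (n : ℕ), (n : ℝ) < S.cycles i (S.ellOpt lam mu i) → x.f i n = S.fOpt lam mu i) →
      S.IsSDPSolution lam mu x.Q →
      S.IsOptimal x) ∧
    (∀ x : MECDesign K N, S.IsOptimal x →
      (∀ i, x.ell i = S.ellOpt lam mu i) ∧
      (∀ i, 0 < lam i ∨ 0 < mu → x.t i = S.tOpt lam mu i) ∧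
      (∀ i, 0 < lam i → ∀ n : ℕ, (n : ℝ) < S.cycles i (S.ellOpt lam mu i) →
        x.f i n = S.fOpt lam mu i) ∧
      S.IsSDPSolution lam mu x.Q) := by
  have hmu := hdual.1.2.1
  have hlam := hdual.1.2.2
  obtain ⟨Q₀, t₀, ell₀, hf₀, hmin₀, hle₀⟩ := hdual.exists_minimizer
  have hopt₀ := hdual.constFreqFeasible_opt hf₀ hle₀
  have hell₀ : ell₀ = S.ellOpt lam mu := funext (hdual.eq_opt hf₀ hle₀).1
  have hsdp₀ := hdual.isSDPSolution hf₀ hmin₀ hle₀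
  have hsuff : ∀ x : MECDesign K N,
      (∀ i, x.ell i = S.ellOpt lam mu i) →
      (∀ i, x.t i = S.tOpt lam mu i) →
      (∀ i (n : ℕ), (n : ℝ) < S.cycles i (S.ellOpt lam mu i) → x.f i n = S.fOpt lam mu i) →
      S.IsSDPSolution lam mu x.Q →
      S.IsOptimal x := by
    intro x hell ht hf hQ
    obtain ⟨h1, h2⟩ := (MECSystem.sdpFeasible_iff hmu).1 hQ.1
    have hx : S.ConstFreqFeasible x.Q x.t x.ell := by
      rw [funext hell, funext ht]
      exact ⟨h1, h2, hopt₀.time, hopt₀.admissible⟩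
    refine ⟨hx.feasible hell hf hfmax, fun y hy => ?_⟩
    have h3 := hmin₀ _ _ _ hy.constFreqFeasible
    have h4 := hQ.2 _ hsdp₀.1
    change S.cost x.Q x.ell ≤ S.cost y.Q y.ell
    refine le_trans ?_ h3
    rw [hell₀, funext hell]
    unfold MECSystem.cost
    linarith
  refine ⟨fun i hl => (S.rOpt_spec hl hmu).1, ⟨Q₀, hsdp₀⟩, hsuff, fun x hx => ?_⟩
  have hxf := hx.1.constFreqFeasible
  have hxle : S.cost x.Q x.ell ≤ S.cost Q₀ ell₀ := by
    rw [hell₀]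
    exact hx.2 ⟨Q₀, S.tOpt lam mu, S.ellOpt lam mu, fun i _ => S.fOpt lam mu i⟩
      (hsuff _ (fun _ => rfl) (fun _ => rfl) (fun _ _ _ => rfl) hsdp₀).1
  have hxdual : ((S.cost x.Q x.ell : ℝ) : EReal) ≤ S.dualFun lam mu :=
    (EReal.coe_le_coe_iff.2 hxle).trans hle₀
  obtain ⟨hell, ht⟩ := hdual.eq_opt hxf hxdual
  refine ⟨hell, ht, fun i hl n hn => ?_, hdual.isSDPSolution hxf
    (fun Q' t' ell' h => hxle.trans (hmin₀ Q' t' ell' h)) hxdual⟩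
  -- complementary slackness: the energy constraint of user `i` is tight at constant frequency
  have htight : S.netEnergy x.Q x.t x.ell i = 0 := by
    have h1 := EReal.coe_le_coe_iff.1
      (hxdual.trans (S.dualFun_le lam mu hxf.posSemidef hxf.admissible))
    rw [S.lagrangian_eq] at h1
    have h2 : ∀ j ∈ Finset.univ, lam j * S.netEnergy x.Q x.t x.ell j ≤ 0 := fun j _ =>
      mul_nonpos_of_nonneg_of_nonpos (hlam j) (hxf.energy j)
    have h3 := mul_nonpos_of_nonneg_of_nonpos hmu (sub_nonpos.2 hxf.time)
    have h4 := Finset.sum_nonpos h2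
    exact (mul_eq_zero.1 ((Finset.sum_eq_zero_iff_of_nonpos h2).1 (by linarith) i
      (Finset.mem_univ i))).resolve_left hl.ne'
  have hen : cycleSum (S.cycles i (x.ell i)) (fun n => x.f i n ^ 2) ≤
      S.cycles i (x.ell i) ^ 3 / S.T ^ 2 := by
    have h1 := hx.1.energy i
    rw [cycleSum_const_mul] at h1
    unfold MECSystem.netEnergy at htight
    rw [← S.mul_cycles_pow_eq] at htight
    exact le_of_mul_le_mul_left (by linarith) (S.κ_pos i)
  rw [← hell] at hn
  rw [(cycleSum_sq_ge (S.cycles_nonneg i (hxf.admissible i).2.2.1) S.T_pos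
    (fun m hm => (hx.1.freq i m hm).1) (hx.1.latency i)).2 hen n hn, hell]
  rfl
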